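/- **Setting.** Let $\mathbb A$ be a nonempty finite subset of a Euclidean space (actions), $\Theta$ a nonempty compact subset of a Euclidean space (parameters), and $\mathbb Y$ a Borel subset of a Euclidean space (consequences). Write $\Delta X$ for the Borel probability measures on $X$. Let $Q(\cdot\mid a)\in\Delta\mathbb Y$ be the true consequence law of action $a$, let $Q_\theta(\cdot\mid a)\in\Delta\mathbb Y$, $\theta\in\Theta$, be the agent's (possibly misspecified) model, and let $\pi:\mathbb A\times\mathbb Y\to\mathbb R$ be a measurable payoff. Assume: * There is a $\sigma$-finite Borel measure $\nu$ on $\mathbb Y$ such that $Q(\cdot\mid a)$ and $Q_\theta(\cdot\mid a)$ have (jointly measurable) densities $q(\cdot\mid a)$ and $q_\theta(\cdot\mid a)$ with respect to $\nu$; for $\nu$-a.e. $y$ the maps $a\mapsto q(y\mid a)$, $(\theta,a)\mapsto q_\theta(y\mid a)$ and $a\mapsto\pi(a,y)$ are continuous. * There are measurable $M:\mathbb Y\to[1,\infty)$ and $r:\mathbb Y\to[0,\infty)$ such that, for all $(\theta,a)$ and $\nu$-a.e. $y$, $$q_\theta(y\mid a)M(y)^{-1}\le q(y\mid a)\le q_\theta(y\mid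 a)M(y),\qquad q(y\mid a)\le r(y),$$ and $\int M r\,d\nu<\infty$. * There is $h:\mathbb Y\to[0,\infty)$ with $|\pi(a,y)|\le h(y)$ for all $a$ and $\nu$-a.e. $y$, and $\int h M r\,d\nu<\infty$. For $\theta\in\Theta$, $a\in\mathbb A$, $\mu\in\Delta\Theta$, $\sigma\in\Delta\mathbb A$ define $$U(a,\theta)=\int\pi(a,y)\,Q_\theta(dy\mid a),\qquad F(\mu)=\arg\max_{a\in\mathbb A}\int_\Theta U(a,\theta)\,\mu(d\theta),$$ $$K(\theta,a)=\int\log\frac{q(y\mid a)}{q_\theta(y\mid a)}\,q(y\mid a)\,\nu(dy),\qquad \Theta^{\mathrm m}(\sigma)=\arg\min_{\theta\in\Theta}\int_{\mathbb A}K(\theta,a)\,\sigma(da).$$ A distribution $\sigma\in\Delta\mathbb A$ is a *generalized Berk–Nash equilibrium* if for every $a\in\operatorname{supp}(\sigma)$ there is a belief $\mu_a\in\Delta\Theta$ with $\operatorname{supp}(\mu_a)\subseteq\Theta^{\mathrm m}(\sigma)$ and $a\in F(\mu_a)$. **Dynamics.** Fix a prior $\mu_1\in\Delta\Theta$ with support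 $\Theta$ and, for each $t\ge1$, a measurable selection rule $\phi_t(\cdot\mid\mu)\in\Delta\mathbb A$, $\mu\in\Delta\Theta$, with $\phi_t(F(\mu)\mid\mu)=1$ for all $\mu$. In period $t=1,2,\dots$ the agent with belief $\mu_t$ draws $a_t\sim\phi_t(\cdot\mid\mu_t)$, a consequence $y_t\sim Q(\cdot\mid a_t)$ is drawn, and the belief is updated by Bayes' rule $$\mu_{t+1}(B)=\frac{\int_B q_\theta(y_t\mid a_t)\,\mu_t(d\theta)}{\int_\Theta q_\theta(y_t\mid a_t)\,\mu_t(d\theta)},\qquad B\subseteq\Theta\text{ Borel}.$$ Let $\mathbf P$ be the induced law on infinite sequences $(a_t,y_t)_{t\ge1}$, and let $\sigma_t=\frac1t\sum_{\tau=1}^t\delta_{a_\tau}$ be the empirical action distribution. **Proposition.** $\mathbf P$-almost surely, the following holds: for every $\sigma\in\Delta\mathbb A$, if $\sigma_t\to\sigma$, then $\sigma$ is a generalized Berk–Nash equilibrium. -/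

import Mathlib

open MeasureTheory ProbabilityTheory Filter Topology
open scoped ENNReal NNReal

namespace MisspecifiedLearning

/-- The primitives of the single-agent decision problem: action space `A`, parameter space `Θ`,
consequence space `Y`. The agent faces the true consequence kernel `Q(· | a)` and entertains the
parametric model `Q_θ(· | a)`. All these laws are dominated by one σ-finite measure `ν`, with
densities `q(y | a)` and `q_θ(y | a)`. -/
structure LearningProblem (A Θ Y : Type*) [MeasurableSpace A] [MeasurableSpace Θ]
    [MeasurableSpace Y] where
  /-- the true kernel `Q` -/
  trueKernel : Kernel A Y
  /-- the subjective kernels `Q_θ` -/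
  modelKernel : Θ → Kernel A Y
  isMarkov_trueKernel : IsMarkovKernel trueKernel
  isMarkov_modelKernel : ∀ θ, IsMarkovKernel (modelKernel θ)
  /-- the dominating measure `ν` -/
  dominating : Measure Y
  sigmaFinite_dominating : SigmaFinite dominating
  /-- the density `q(y | a)` -/
  trueDensity : A → Y → ℝ≥0
  /-- the density `q_θ(y | a)` -/
  modelDensity : Θ → A → Y → ℝ≥0
  measurable_trueDensity : Measurable fun p : A × Y => trueDensity p.1 p.2
  measurable_modelDensity : Measurable fun p : Θ × A × Y => modelDensity p.1 p.2.1 p.2.2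
  trueKernel_eq : ∀ a, trueKernel a = dominating.withDensity fun y => (trueDensity a y : ℝ≥0∞)
  modelKernel_eq : ∀ θ a,
    modelKernel θ a = dominating.withDensity fun y => (modelDensity θ a y : ℝ≥0∞)
  /-- the per-period payoff `π(a, y)` -/
  payoff : A → Y → ℝ
  measurable_payoff : Measurable fun p : A × Y => payoff p.1 p.2

namespace LearningProblem

variable {A Θ Y : Type*} [MeasurableSpace A] [MeasurableSpace Θ] [MeasurableSpace Y]

/-- Almost-everywhere continuity of the kernels and of the payoff, the likelihood ratio envelope,
and the domination of the payoff. -/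
structure StandingAssumptions [TopologicalSpace A] [TopologicalSpace Θ]
    (E : LearningProblem A Θ Y) : Prop where
  continuous_trueDensity : ∀ᵐ y ∂E.dominating, Continuous fun a => E.trueDensity a y
  continuous_modelDensity : ∀ᵐ y ∂E.dominating,
    Continuous fun p : Θ × A => E.modelDensity p.1 p.2 y
  continuous_payoff : ∀ᵐ y ∂E.dominating, Continuous fun a => E.payoff a y
  envelope : ∃ M r h : Y → ℝ, Measurable M ∧ Measurable r ∧
    (∀ y, 1 ≤ M y) ∧ (∀ y, 0 ≤ r y) ∧ (∀ y, 0 ≤ h y) ∧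
    (∀ θ a, ∀ᵐ y ∂E.dominating,
      (E.modelDensity θ a y : ℝ) * (M y)⁻¹ ≤ E.trueDensity a y ∧
      (E.trueDensity a y : ℝ) ≤ E.modelDensity θ a y * M y ∧
      (E.trueDensity a y : ℝ) ≤ r y) ∧
    Integrable (fun y => M y * r y) E.dominating ∧
    (∀ a, ∀ᵐ y ∂E.dominating, |E.payoff a y| ≤ h y) ∧
    Integrable (fun y => h y * M y * r y) E.dominating

variable (E : LearningProblem A Θ Y)

instance : IsMarkovKernel E.trueKernel := E.isMarkov_trueKernel

/-- `U(a, θ)`, the expected payoff of action `a` under the model `θ`. -/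
noncomputable def expectedPayoff (a : A) (θ : Θ) : ℝ :=
  ∫ y, E.payoff a y ∂(E.modelKernel θ a)

/-- `F(μ)`, the set of actions that maximize the subjective expected payoff under belief `μ`. -/
def optimalActions (μ : ProbabilityMeasure Θ) : Set A :=
  {a | ∀ a', ∫ θ, E.expectedPayoff a' θ ∂(μ : Measure Θ)
    ≤ ∫ θ, E.expectedPayoff a θ ∂(μ : Measure Θ)}

/-- `K(θ, a)`, the Kullback–Leibler divergence of `Q_θ(· | a)` from `Q(· | a)`. -/
noncomputable def klDivergence (θ : Θ) (a : A) : ℝ :=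
  ∫ y, Real.log ((E.trueDensity a y : ℝ) / E.modelDensity θ a y) * E.trueDensity a y
    ∂E.dominating

/-- `Θᵐ(σ)`, the set of parameters minimizing the `σ`-average of the divergence. -/
def klMinimizers (σ : ProbabilityMeasure A) : Set Θ :=
  {θ | ∀ θ', ∫ a, E.klDivergence θ a ∂(σ : Measure A)
    ≤ ∫ a, E.klDivergence θ' a ∂(σ : Measure A)}

/-- Generalized Berk–Nash equilibrium: every action in the support of `σ` is optimal for some
belief, possibly depending on the action, that is supported on the minimizers at `σ`. -/
def IsGeneralizedBerkNash [TopologicalSpace A] [TopologicalSpace Θ]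
    (σ : ProbabilityMeasure A) : Prop :=
  ∀ a ∈ (σ : Measure A).support, ∃ μ : ProbabilityMeasure Θ,
    (μ : Measure Θ).support ⊆ E.klMinimizers σ ∧ a ∈ E.optimalActions μ

/-- The predictive density `∫ q_θ(y | a) μ(dθ)` of the observation `z = (a, y)`. -/
noncomputable def evidence (μ : ProbabilityMeasure Θ) (z : A × Y) : ℝ≥0∞ :=
  ∫⁻ θ, (E.modelDensity θ z.1 z.2 : ℝ≥0∞) ∂(μ : Measure Θ)

open Classical in
/-- Bayes' rule after the observation `z = (a, y)`: the posterior of `B` is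
`∫_B q_θ(y | a) μ(dθ) / ∫ q_θ(y | a) μ(dθ)`. Where this is not defined (denominator `0` or `∞`)
the belief is left unchanged. -/
noncomputable def bayesMeasure (μ : ProbabilityMeasure Θ) (z : A × Y) : Measure Θ :=
  if E.evidence μ z ≠ 0 ∧ E.evidence μ z ≠ ∞ then
    (E.evidence μ z)⁻¹ •
      (μ : Measure Θ).withDensity fun θ => (E.modelDensity θ z.1 z.2 : ℝ≥0∞)
  else μ

theorem isProbabilityMeasure_bayesMeasure (μ : ProbabilityMeasure Θ) (z : A × Y) :
    IsProbabilityMeasure (E.bayesMeasure μ z) := by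
  unfold bayesMeasure
  split_ifs with h
  · refine ⟨?_⟩
    rw [Measure.smul_apply, withDensity_apply _ MeasurableSet.univ, Measure.restrict_univ]
    exact ENNReal.inv_mul_cancel h.1 h.2
  · infer_instance

/-- The updated belief after the observation `z = (a, y)`. -/
noncomputable def bayesUpdate (μ : ProbabilityMeasure Θ) (z : A × Y) : ProbabilityMeasure Θ :=
  ⟨E.bayesMeasure μ z, E.isProbabilityMeasure_bayesMeasure μ z⟩

theorem measurable_setLIntegral {s : Set Θ} (hs : MeasurableSet s) :
    Measurable fun p : ProbabilityMeasure Θ × (A × Y) =>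
      ∫⁻ θ in s, (E.modelDensity θ p.2.1 p.2.2 : ℝ≥0∞) ∂(p.1 : Measure Θ) := by
  let κ : Kernel (ProbabilityMeasure Θ × (A × Y)) Θ :=
    ⟨fun p => (p.1 : Measure Θ), measurable_subtype_coe.comp measurable_fst⟩
  have : IsMarkovKernel κ := ⟨fun p => p.1.2⟩
  have hf : Measurable fun p : (ProbabilityMeasure Θ × (A × Y)) × Θ =>
      (E.modelDensity p.2 p.1.2.1 p.1.2.2 : ℝ≥0∞) :=
    (E.measurable_modelDensity.comp
      (measurable_snd.prodMk (measurable_snd.comp measurable_fst))).coe_nnreal_ennreal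
  exact Measurable.setLIntegral_kernel_prod_right (κ := κ)
    (f := fun (p : ProbabilityMeasure Θ × (A × Y)) θ => (E.modelDensity θ p.2.1 p.2.2 : ℝ≥0∞)) hf hs

theorem measurable_bayesUpdate :
    Measurable fun p : ProbabilityMeasure Θ × (A × Y) => E.bayesUpdate p.1 p.2 := by
  have hev : Measurable fun p : ProbabilityMeasure Θ × (A × Y) => E.evidence p.1 p.2 := by
    simpa [evidence] using E.measurable_setLIntegral MeasurableSet.univ
  have hset : MeasurableSet {p : ProbabilityMeasure Θ × (A × Y) |
      E.evidence p.1 p.2 ≠ 0 ∧ E.evidence p.1 p.2 ≠ ∞} :=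
    (hev (measurableSet_singleton 0).compl).inter (hev (measurableSet_singleton ∞).compl)
  refine Measurable.subtype_mk (Measure.measurable_of_measurable_coe _ fun s hs => ?_)
  have hco : Measurable fun p : ProbabilityMeasure Θ × (A × Y) => (p.1 : Measure Θ) s :=
    (Measure.measurable_coe hs).comp (measurable_subtype_coe.comp measurable_fst)
  have key := @Measurable.ite _ _ _ _ _ _ _ (fun _ => Classical.propDecidable _) hset
    (hev.inv.mul (E.measurable_setLIntegral hs)) hco
  refine (congrArg Measurable (funext fun p => ?_)).mpr key
  by_cases h : E.evidence p.1 p.2 ≠ 0 ∧ E.evidence p.1 p.2 ≠ ∞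
  · rw [if_pos (by exact h), bayesMeasure, if_pos h, Measure.smul_apply, withDensity_apply _ hs]
    rfl
  · rw [if_neg (by exact h), bayesMeasure, if_neg h]

/-- The belief `μ` held after the first `n + 1` periods, with prior `μ₀`, as a function of the
actions and consequences `h 0, …, h n` of these periods. -/
noncomputable def posterior (μ₀ : ProbabilityMeasure Θ) :
    (n : ℕ) → (Finset.Iic n → A × Y) → ProbabilityMeasure Θ
  | 0, h => E.bayesUpdate μ₀ (h ⟨0, Finset.mem_Iic.2 le_rfl⟩)
  | n + 1, h =>
    E.bayesUpdate (posterior μ₀ n (Preorder.frestrictLe₂ (π := fun _ => A × Y) n.le_succ h))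
      (h ⟨n + 1, Finset.mem_Iic.2 le_rfl⟩)

theorem measurable_posterior (μ₀ : ProbabilityMeasure Θ) (n : ℕ) :
    Measurable (E.posterior μ₀ n) := by
  induction n with
  | zero => exact E.measurable_bayesUpdate.comp (measurable_const.prodMk (measurable_pi_apply _))
  | succ n ih =>
    exact E.measurable_bayesUpdate.comp
      ((ih.comp (Preorder.measurable_frestrictLe₂ n.le_succ)).prodMk (measurable_pi_apply _))

/-- One period of play from a belief `μ`: an action `a` is drawn from `φ(· | μ)`, then a
consequence is drawn from the true kernel `Q(· | a)`. -/
noncomputable def periodKernel (φ : Kernel (ProbabilityMeasure Θ) A) :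
    Kernel (ProbabilityMeasure Θ) (A × Y) :=
  φ ⊗ₖ E.trueKernel.prodMkLeft (ProbabilityMeasure Θ)

instance (φ : Kernel (ProbabilityMeasure Θ) A) [IsMarkovKernel φ] :
    IsMarkovKernel (E.periodKernel φ) := by
  unfold periodKernel; infer_instance

/-- The law `P` of the infinite sequence of actions and consequences that is induced by the prior
`μ₀`, the selection rules `φ` and the true kernel. Periods are numbered from `0`: the first action
is chosen at the prior, and the action of period `n + 1` is chosen at the posterior given
periods `0, …, n`. -/
noncomputable def pathLaw (μ₀ : ProbabilityMeasure Θ) (φ : ℕ → Kernel (ProbabilityMeasure Θ) A)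
    [∀ t, IsMarkovKernel (φ t)] : Measure (ℕ → A × Y) :=
  Kernel.trajMeasure (X := fun _ => A × Y) (E.periodKernel (φ 0) μ₀) fun n =>
    (E.periodKernel (φ (n + 1))).comap (E.posterior μ₀ n) (E.measurable_posterior μ₀ n)

end LearningProblem

/-- The empirical distribution of the first `n + 1` terms of a sequence of actions. -/
noncomputable def empiricalDistribution {A : Type*} [MeasurableSpace A] (x : ℕ → A) (n : ℕ) :
    ProbabilityMeasure A :=
  ⟨((n : ℝ≥0∞) + 1)⁻¹ • ∑ i ∈ Finset.range (n + 1), Measure.dirac (x i), ⟨by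
    simp only [Measure.smul_apply, Measure.finsetSum_apply, measure_univ, Finset.sum_const,
      Finset.card_range, smul_eq_mul, nsmul_eq_mul, mul_one, Nat.cast_add, Nat.cast_one]
    exact ENNReal.inv_mul_cancel (by simp) (by simp)⟩⟩

end MisspecifiedLearning

/-! Multiplying out Bayes' rule, the posterior after `n + 1` periods has density with respect to the
prior proportional to `exp (-(n + 1) ℓ n θ)`, where `ℓ n θ` is the average log-likelihood ratio
along the path. If the empirical distribution converges to `σ`, then `ℓ n` converges uniformly to `L
θ = ∫ K(θ, a) σ(da)`, so by Laplace's principle and full support of the prior the beliefs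
concentrate on the minimizers of `L`. An action in the support of `σ` is played infinitely often; a
limit of the beliefs along those periods is supported on the minimizers, and optimality of the
action passes to the limit because `U` is continuous in the parameter.

The difficulty is that `σ` and the parameter range over uncountable sets, while a law of large
numbers costs a null set each time. The law is therefore applied to functions of `(a, y)` centred at
their mean given the action, for a countable family: the log-ratios at a dense sequence of
parameters and their oscillations at the scales `1 / (k + 1)`. These null sets do not involve `σ`.
The centring terms depend on the action only and converge as soon as the empirical distribution
does. Small average oscillation extends convergence from the dense sequence to all parameters
uniformly. -/

/-! ### Strong law for martingale differences -/

/-- Kronecker's lemma with weights `i + 1`. -/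
theorem tendsto_average_zero_of_tendsto_sum_div {x : ℕ → ℝ} {s : ℝ}
    (h : Tendsto (fun n => ∑ i ∈ Finset.range n, x i / (i + 1)) atTop (𝓝 s)) :
    Tendsto (fun n : ℕ => (n : ℝ)⁻¹ * ∑ i ∈ Finset.range n, x i) atTop (𝓝 0) := by
  set S : ℕ → ℝ := fun n => ∑ i ∈ Finset.range n, x i / (i + 1) with hS
  -- Abel summation: after division by `n`, the average is `S n` minus its Cesàro mean, and both
  -- tend to `s`.
  have abel : ∀ n : ℕ, ∑ i ∈ Finset.range n, x i = n * S n - ∑ i ∈ Finset.range n, S i := by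
    intro n
    induction n with
    | zero => simp
    | succ n ih =>
      have hSn : S (n + 1) = S n + x n / (n + 1) := by simp [hS, Finset.sum_range_succ]
      rw [Finset.sum_range_succ, Finset.sum_range_succ, ih, hSn]
      have : (n : ℝ) + 1 ≠ 0 := by positivity
      push_cast
      field_simp
      ring
  have hlim : Tendsto (fun n : ℕ => S n - (n : ℝ)⁻¹ * ∑ i ∈ Finset.range n, S i)
      atTop (𝓝 0) := by
    simpa using h.sub h.cesaro
  refine hlim.congr' ?_
  filter_upwards [eventually_ne_atTop 0] with n hn
  have : (n : ℝ) ≠ 0 := by exact_mod_cast hn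
  rw [abel n]
  field_simp

/-- The strong law of large numbers for martingale differences with bounded second moments. -/
theorem ae_tendsto_average_zero_of_martingaleDifference {Ω : Type*} {m0 : MeasurableSpace Ω}
    {P : Measure Ω} [IsProbabilityMeasure P] {ℱ : Filtration ℕ m0} {X : ℕ → Ω → ℝ} {C : ℝ}
    (hadp : ∀ n, StronglyMeasurable[ℱ n] (X n)) (hL2 : ∀ n, MemLp (X n) 2 P)
    (hC : ∀ n, ∫ ω, X n ω ^ 2 ∂P ≤ C) (hzero : ∀ n, P[X (n + 1)|ℱ n] =ᵐ[P] 0) :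
    ∀ᵐ ω ∂P, Tendsto (fun n : ℕ => (n : ℝ)⁻¹ * ∑ i ∈ Finset.range n, X i ω) atTop (𝓝 0) := by
  have hC0 : 0 ≤ C := (integral_nonneg fun ω => sq_nonneg (X 0 ω)).trans (hC 0)
  -- The weighted sums form an L²-bounded martingale, since the increments are orthogonal; its
  -- almost sure convergence feeds Kronecker's lemma.
  set M : ℕ → Ω → ℝ := fun n ω => ∑ i ∈ Finset.range (n + 1), X i ω / (i + 1) with hM
  have hMsucc : ∀ n, M (n + 1) = M n + fun ω => ((n : ℝ) + 2)⁻¹ * X (n + 1) ω := by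
    intro n
    ext ω
    simp only [hM, Finset.sum_range_succ _ (n + 1), Pi.add_apply, div_eq_inv_mul]
    push_cast
    ring_nf
  have hMadp : ∀ n, StronglyMeasurable[ℱ n] (M n) := fun n =>
    Finset.stronglyMeasurable_fun_sum _ fun i hi => by
      simpa only [div_eq_inv_mul] using StronglyMeasurable.const_mul
        ((hadp i).mono (ℱ.mono (Nat.lt_succ_iff.1 (Finset.mem_range.1 hi)))) ((i : ℝ) + 1)⁻¹
  have hML2 : ∀ n, MemLp (M n) 2 P := fun n =>
    memLp_finsetSum _ fun i _ => by
      simpa only [div_eq_inv_mul] using (hL2 i).const_mul ((i : ℝ) + 1)⁻¹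
  have hXint : ∀ n, Integrable (X n) P := fun n => (hL2 n).integrable one_le_two
  have hMint : ∀ n, Integrable (M n) P := fun n => (hML2 n).integrable one_le_two
  have hmart : Martingale M ℱ P := by
    refine martingale_nat hMadp hMint fun n => ?_
    rw [hMsucc n]
    have h1 := condExp_add (m := ℱ n) (hMint n) ((hXint (n + 1)).const_mul ((n : ℝ) + 2)⁻¹)
    have h2 := condExp_smul (μ := P) ((n : ℝ) + 2)⁻¹ (X (n + 1)) (ℱ n)
    have h3 := condExp_of_stronglyMeasurable (ℱ.le n) (hMadp n) (hMint n)
    filter_upwards [h1, h2, hzero n] with ω e1 e2 e3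
    rw [e1, Pi.add_apply, h3]
    have : (fun ω => ((n : ℝ) + 2)⁻¹ * X (n + 1) ω) = ((n : ℝ) + 2)⁻¹ • X (n + 1) := rfl
    rw [this, e2, Pi.smul_apply, e3]
    simp
  have hcross : ∀ n, ∫ ω, M n ω * X (n + 1) ω ∂P = 0 := by
    intro n
    have hint : Integrable (M n * X (n + 1)) P := (hML2 n).integrable_mul (hL2 (n + 1))
    have h1 := condExp_mul_of_stronglyMeasurable_left (hMadp n) hint (hXint (n + 1))
    have h2 : ∫ ω, (M n * X (n + 1)) ω ∂P = ∫ ω, (P[M n * X (n + 1)|ℱ n]) ω ∂P :=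
      (integral_condExp (ℱ.le n)).symm
    change ∫ ω, (M n * X (n + 1)) ω ∂P = 0
    rw [h2, integral_eq_zero_of_ae]
    filter_upwards [h1, hzero n] with ω e1 e2
    rw [e1, Pi.mul_apply, e2]
    simp
  -- The factor `2 - 1 / (n + 1)` majorizes the sum of `1 / (i + 1) ^ 2`, by telescoping `1 / (n +
  -- 2) ^ 2 ≤ 1 / (n + 1) - 1 / (n + 2)`.
  have hsq : ∀ n : ℕ, ∫ ω, M n ω ^ 2 ∂P ≤ C * (2 - ((n : ℝ) + 1)⁻¹) := by
    intro n
    induction n with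
    | zero =>
      have h0 := hC 0
      simp only [hM, zero_add, Finset.range_one, Finset.sum_singleton, CharP.cast_eq_zero, div_one]
      norm_num
      exact h0
    | succ n ih =>
      have hexp : ∀ ω, M (n + 1) ω ^ 2 = M n ω ^ 2 +
          (2 * ((n : ℝ) + 2)⁻¹ * (M n ω * X (n + 1) ω) +
            (((n : ℝ) + 2)⁻¹) ^ 2 * X (n + 1) ω ^ 2) := by
        intro ω
        rw [hMsucc n, Pi.add_apply]
        ring
      have i1 : Integrable (fun ω => M n ω ^ 2) P := (hML2 n).integrable_sq
      have i2 : Integrable (fun ω => 2 * ((n : ℝ) + 2)⁻¹ * (M n ω * X (n + 1) ω)) P :=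
        ((hML2 n).integrable_mul (hL2 (n + 1))).const_mul _
      have i3 : Integrable (fun ω => (((n : ℝ) + 2)⁻¹) ^ 2 * X (n + 1) ω ^ 2) P :=
        (hL2 (n + 1)).integrable_sq.const_mul _
      simp_rw [hexp]
      have e1 := integral_add i1 (i2.add i3)
      simp only [Pi.add_apply] at e1
      rw [e1, integral_add i2 i3, integral_const_mul, integral_const_mul, hcross n]
      have hX := hC (n + 1)
      have hw : (((n : ℝ) + 2)⁻¹) ^ 2 ≤ ((n : ℝ) + 1)⁻¹ - ((n : ℝ) + 2)⁻¹ := by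
        have h1 : (0 : ℝ) < (n : ℝ) + 1 := by positivity
        have h2 : (0 : ℝ) < (n : ℝ) + 2 := by positivity
        rw [inv_sub_inv h1.ne' h2.ne', inv_pow, inv_eq_one_div, div_le_div_iff₀ (by positivity)
          (by positivity)]
        nlinarith
      have hcast : (((n + 1 : ℕ) : ℝ) + 1) = (n : ℝ) + 2 := by push_cast; ring
      rw [hcast]
      have hXw : (((n : ℝ) + 2)⁻¹) ^ 2 * ∫ ω, X (n + 1) ω ^ 2 ∂P
          ≤ (((n : ℝ) + 1)⁻¹ - ((n : ℝ) + 2)⁻¹) * C :=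
        mul_le_mul hw hX (integral_nonneg fun ω => sq_nonneg _) ((sq_nonneg _).trans hw)
      nlinarith
  have hL1 : ∀ n, eLpNorm (M n) 1 P ≤ ((1 + C * 2).toNNReal : ℝ≥0) := by
    intro n
    rw [eLpNorm_one_eq_lintegral_enorm, ← ofReal_integral_norm_eq_lintegral_enorm (hMint n)]
    refine ENNReal.ofReal_le_ofReal ?_
    have h1 : ∫ ω, ‖M n ω‖ ∂P ≤ ∫ ω, (1 + M n ω ^ 2) ∂P := by
      refine integral_mono (hMint n).norm ((integrable_const _).add (hML2 n).integrable_sq)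
        fun ω => ?_
      simp only [Real.norm_eq_abs]
      nlinarith [sq_abs (M n ω), sq_nonneg (|M n ω| - 1), abs_nonneg (M n ω)]
    rw [integral_add (integrable_const _) (hML2 n).integrable_sq] at h1
    have h2 := hsq n
    have h3 : (0 : ℝ) ≤ ((n : ℝ) + 1)⁻¹ := by positivity
    simp only [integral_const, probReal_univ, smul_eq_mul, mul_one] at h1
    nlinarith
  filter_upwards [hmart.submartingale.ae_tendsto_limitProcess hL1] with ω hω
  exact tendsto_average_zero_of_tendsto_sum_div ((tendsto_add_atTop_iff_nat 1).1 hω)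

/-! ### One-step conditioning and the strong law under a trajectory measure -/

namespace ProbabilityTheory.Kernel

variable {X : ℕ → Type*} [∀ n, MeasurableSpace (X n)]
  {κ : (n : ℕ) → Kernel ((i : Finset.Iic n) → X i) (X (n + 1))} [∀ n, IsMarkovKernel (κ n)]
  {μ₀ : Measure (X 0)}

theorem map_eval_zero_trajMeasure :
    (trajMeasure μ₀ κ).map (fun x => x 0) = μ₀ := by
  have h1 : (trajMeasure μ₀ κ).map (Preorder.frestrictLe 0)
      = μ₀.map (MeasurableEquiv.piUnique (fun i : Finset.Iic 0 => X i)).symm := by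
    rw [trajMeasure, Measure.map_comp _ _ (by fun_prop), traj_map_frestrictLe, partialTraj_self]
    exact Measure.id_comp
  let e : ((i : Finset.Iic 0) → X i) → X 0 := fun x => x ⟨0, Finset.mem_Iic.2 le_rfl⟩
  have he : Measurable e := measurable_pi_apply _
  have h2 : (fun x : (n : ℕ) → X n => x 0) = e ∘ Preorder.frestrictLe 0 := rfl
  have h3 : e ∘ (MeasurableEquiv.piUnique (fun i : Finset.Iic 0 => X i)).symm = id := rfl
  rw [h2, ← Measure.map_map he (by fun_prop), h1]
  refine (Measure.map_map he (MeasurableEquiv.measurable _)).trans ?_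
  exact (congrArg (fun f => Measure.map f μ₀) h3).trans Measure.map_id

variable [IsProbabilityMeasure μ₀]

/-- The history up to `n` and the next coordinate are jointly distributed as the composition-product
of the law of the history with `κ n`. This and the next two lemmas thereby reduce to one kernel
step. -/
theorem ae_trajMeasure_succ {n : ℕ} {p : ((i : Finset.Iic n) → X i) × X (n + 1) → Prop}
    (hp : MeasurableSet {x | p x}) (h : ∀ x, ∀ᵐ z ∂κ n x, p (x, z)) :
    ∀ᵐ ω ∂trajMeasure μ₀ κ, p (Preorder.frestrictLe n ω, ω (n + 1)) := by
  have h1 := (Measure.ae_compProd_iff (μ := (trajMeasure μ₀ κ).map (Preorder.frestrictLe n))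
    hp).2 (Eventually.of_forall h)
  rw [map_frestrictLe_trajMeasure_compProd_eq_map_trajMeasure] at h1
  exact ae_of_ae_map (by fun_prop) h1

theorem lintegral_trajMeasure_succ {n : ℕ} {f : X (n + 1) → ℝ≥0∞} (hf : Measurable f) {C : ℝ≥0∞}
    (h : ∀ x, ∫⁻ z, f z ∂κ n x ≤ C) : ∫⁻ ω, f (ω (n + 1)) ∂trajMeasure μ₀ κ ≤ C := by
  have h1 : ∫⁻ ω, f (ω (n + 1)) ∂trajMeasure μ₀ κ = ∫⁻ p, f p.2 ∂((trajMeasure μ₀ κ).map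
      (fun x => (Preorder.frestrictLe n x, x (n + 1)))) := by
    rw [MeasureTheory.lintegral_map (by fun_prop) (by fun_prop)]
  rw [h1, ← map_frestrictLe_trajMeasure_compProd_eq_map_trajMeasure,
    Measure.lintegral_compProd (by fun_prop)]
  have : IsProbabilityMeasure ((trajMeasure μ₀ κ).map (Preorder.frestrictLe n)) :=
    Measure.isProbabilityMeasure_map (by fun_prop)
  exact (lintegral_mono h).trans (by simp)

theorem condExp_trajMeasure_succ_eq_zero {n : ℕ} {g : X (n + 1) → ℝ} (hg : Measurable g)
    (hint : Integrable (fun ω => g (ω (n + 1))) (trajMeasure μ₀ κ))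
    (h : ∀ x, ∫ z, g z ∂κ n x = 0) :
    (trajMeasure μ₀ κ)[fun ω => g (ω (n + 1))|Filtration.piLE (X := X) n]
      =ᵐ[trajMeasure μ₀ κ] 0 := by
  refine (ae_eq_condExp_of_forall_setIntegral_eq (Filtration.piLE.le n) hint
    (fun _ _ _ => integrableOn_zero) ?_ aestronglyMeasurable_zero).symm
  rintro s hs -
  rw [Filtration.piLE_eq_comap_frestrictLe] at hs
  -- An event of the past is a set `t` of histories, so its indicator is constant in the next
  -- coordinate and the inner integral of `g` vanishes.
  obtain ⟨t, ht, rfl⟩ := hs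
  have hpair : Measurable fun x : (n : ℕ) → X n => (Preorder.frestrictLe (π := X) n x, x (n + 1)) :=
    by fun_prop
  have hgm : AEStronglyMeasurable (fun p : ((i : Finset.Iic n) → X i) × X (n + 1) =>
      (t ×ˢ Set.univ).indicator (fun p => g p.2) p)
      ((trajMeasure μ₀ κ).map fun x => (Preorder.frestrictLe n x, x (n + 1))) :=
    ((hg.comp measurable_snd).indicator (ht.prod MeasurableSet.univ)).aestronglyMeasurable
  have hms : MeasurableSet (Preorder.frestrictLe (π := X) n ⁻¹' t) :=
    (Preorder.measurable_frestrictLe n) ht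
  have h1 : ∫ ω in Preorder.frestrictLe n ⁻¹' t, g (ω (n + 1)) ∂trajMeasure μ₀ κ =
      ∫ p, (t ×ˢ Set.univ).indicator (fun p => g p.2) p ∂((trajMeasure μ₀ κ).map
      (fun x => (Preorder.frestrictLe n x, x (n + 1)))) := by
    rw [integral_map hpair.aemeasurable hgm, ← integral_indicator hms]
    congr 1 with ω
    by_cases hω : Preorder.frestrictLe n ω ∈ t <;> simp [Set.indicator, hω]
  have hint' : Integrable (fun p : ((i : Finset.Iic n) → X i) × X (n + 1) =>
      (t ×ˢ Set.univ).indicator (fun p => g p.2) p)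
      ((trajMeasure μ₀ κ).map fun x => (Preorder.frestrictLe n x, x (n + 1))) := by
    rw [integrable_map_measure hgm hpair.aemeasurable]
    refine (hint.indicator hms).congr (Eventually.of_forall fun ω => ?_)
    by_cases hω : Preorder.frestrictLe n ω ∈ t <;> simp [Set.indicator, hω]
  change ∫ ω in Preorder.frestrictLe n ⁻¹' t, (0 : ((n : ℕ) → X n) → ℝ) ω ∂trajMeasure μ₀ κ
    = ∫ ω in Preorder.frestrictLe n ⁻¹' t, g (ω (n + 1)) ∂trajMeasure μ₀ κ
  rw [h1, ← map_frestrictLe_trajMeasure_compProd_eq_map_trajMeasure, Measure.integral_compProd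
    (by rwa [map_frestrictLe_trajMeasure_compProd_eq_map_trajMeasure])]
  have hin : ∀ x, ∫ z, (t ×ˢ Set.univ).indicator
      (fun p : ((i : Finset.Iic n) → X i) × X (n + 1) => g p.2) (x, z) ∂κ n x = 0 := by
    intro x
    by_cases hx : x ∈ t <;> simp [Set.indicator, hx, h x]
  simp [hin]

/-- The strong law of large numbers along trajectories, for a function with conditional mean `0`
and bounded conditional second moments. -/
theorem ae_tendsto_average_zero_trajMeasure {Z : Type*} [MeasurableSpace Z]
    {κ : (n : ℕ) → Kernel (Finset.Iic n → Z) Z} [∀ n, IsMarkovKernel (κ n)]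
    {μ₀ : Measure Z} [IsProbabilityMeasure μ₀] {g : Z → ℝ} (hg : Measurable g) {C : ℝ≥0}
    (hμ₀ : ∫⁻ z, ‖g z‖ₑ ^ 2 ∂μ₀ ≤ C) (hκ : ∀ n x, ∫⁻ z, ‖g z‖ₑ ^ 2 ∂κ n x ≤ C)
    (hzero : ∀ n x, ∫ z, g z ∂κ n x = 0) :
    ∀ᵐ ω ∂trajMeasure (X := fun _ => Z) μ₀ κ,
      Tendsto (fun n : ℕ => (n : ℝ)⁻¹ * ∑ i ∈ Finset.range n, g (ω i)) atTop (𝓝 0) := by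
  set P := trajMeasure (X := fun _ => Z) μ₀ κ with hP
  have hsq : Measurable fun z => ‖g z‖ₑ ^ 2 := hg.enorm.pow_const 2
  have hmom : ∀ n, ∫⁻ ω, ‖g (ω n)‖ₑ ^ 2 ∂P ≤ C := by
    intro n
    cases n with
    | zero =>
      have h1 : ∫⁻ ω, ‖g (ω 0)‖ₑ ^ 2 ∂P = ∫⁻ z, ‖g z‖ₑ ^ 2 ∂(P.map fun x => x 0) := by
        rw [MeasureTheory.lintegral_map hsq (by fun_prop)]
      rw [h1, hP, map_eval_zero_trajMeasure (X := fun _ => Z)]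
      exact hμ₀
    | succ n => exact lintegral_trajMeasure_succ (X := fun _ => Z) hsq (hκ n)
  have hL2 : ∀ n, MemLp (fun ω : ℕ → Z => g (ω n)) 2 P := by
    intro n
    refine ⟨(hg.comp (measurable_pi_apply n)).aestronglyMeasurable, ?_⟩
    rw [eLpNorm_lt_top_iff_lintegral_rpow_enorm_lt_top two_ne_zero ENNReal.ofNat_ne_top]
    simpa using (hmom n).trans_lt ENNReal.coe_lt_top
  refine ae_tendsto_average_zero_of_martingaleDifference (ℱ := Filtration.piLE)
    (X := fun n (ω : ℕ → Z) => g (ω n)) (C := C) (fun n => ?_) hL2 (fun n => ?_) fun n => ?_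
  · refine Measurable.stronglyMeasurable ?_
    have : (fun ω : ℕ → Z => g (ω n)) = (fun x : Finset.Iic n → Z =>
        g (x ⟨n, Finset.mem_Iic.2 le_rfl⟩)) ∘ Preorder.frestrictLe (π := fun _ => Z) n := rfl
    rw [this, Filtration.piLE_eq_comap_frestrictLe]
    exact (hg.comp (measurable_pi_apply _)).comp (comap_measurable _)
  · rw [integral_eq_lintegral_of_nonneg_ae (Eventually.of_forall fun ω => sq_nonneg _)
      (hL2 n).integrable_sq.aestronglyMeasurable]
    refine ENNReal.toReal_le_coe_of_le_coe (le_trans (le_of_eq ?_) (hmom n))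
    refine lintegral_congr fun ω => ?_
    rw [← ofReal_norm, ← ENNReal.ofReal_pow (norm_nonneg _), Real.norm_eq_abs, sq_abs]
  · exact condExp_trajMeasure_succ_eq_zero (X := fun _ => Z) hg ((hL2 n.succ).integrable one_le_two)
      (hzero n)

end ProbabilityTheory.Kernel

/-! ### Log-likelihood ratios and their oscillation at a single observation -/

namespace MisspecifiedLearning.LearningProblem

section Pathwise

variable {A Θ Y : Type*} [MeasurableSpace A] [MeasurableSpace Θ] [MeasurableSpace Y]
  (E : LearningProblem A Θ Y)

/-- The log-likelihood ratio `log (q(y | a) / q_θ(y | a))` at the observation `z = (a, y)`. -/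
noncomputable def logRatio (θ : Θ) (z : A × Y) : ℝ :=
  Real.log ((E.trueDensity z.1 z.2 : ℝ) / E.modelDensity θ z.1 z.2)

theorem measurable_logRatio (θ : Θ) : Measurable (E.logRatio θ) := by
  have h1 : Measurable fun z : A × Y => E.trueDensity z.1 z.2 := E.measurable_trueDensity
  have h2 : Measurable fun z : A × Y => E.modelDensity θ z.1 z.2 :=
    E.measurable_modelDensity.comp (measurable_const.prodMk measurable_id)
  exact (h1.coe_nnreal_real.div h2.coe_nnreal_real).log

/-- The expectation of `f (a, y)` under the true law of the consequence `y` of `a`. -/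
noncomputable def trueMean (f : A × Y → ℝ) (a : A) : ℝ := ∫ y, f (a, y) ∂E.trueKernel a

theorem integral_trueKernel (a : A) (g : Y → ℝ) :
    ∫ y, g y ∂E.trueKernel a = ∫ y, g y * E.trueDensity a y ∂E.dominating := by
  have hm : Measurable (E.trueDensity a) :=
    E.measurable_trueDensity.comp (measurable_const.prodMk measurable_id)
  rw [E.trueKernel_eq a, integral_withDensity_eq_integral_smul hm]
  simp only [NNReal.smul_def, smul_eq_mul, mul_comm]

theorem integral_modelKernel (θ : Θ) (a : A) (g : Y → ℝ) :
    ∫ y, g y ∂E.modelKernel θ a = ∫ y, g y * E.modelDensity θ a y ∂E.dominating := by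
  have hm : Measurable (E.modelDensity θ a) :=
    E.measurable_modelDensity.comp
      (measurable_const.prodMk (measurable_const.prodMk measurable_id))
  rw [E.modelKernel_eq θ a, integral_withDensity_eq_integral_smul hm]
  simp only [NNReal.smul_def, smul_eq_mul, mul_comm]

theorem trueMean_logRatio (θ : Θ) : E.trueMean (E.logRatio θ) = E.klDivergence θ := by
  ext a
  exact E.integral_trueKernel a _

/-- The observations at which the likelihood is continuous in the parameter and comparable with the
positive true density, up to the factor `M`. -/
structure IsRegular [TopologicalSpace Θ] (M : Y → ℝ) (z : A × Y) : Prop where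
  pos : 0 < E.trueDensity z.1 z.2
  one_le : 1 ≤ M z.2
  continuous : Continuous fun θ => E.modelDensity θ z.1 z.2
  lower : ∀ θ, (E.modelDensity θ z.1 z.2 : ℝ) ≤ E.trueDensity z.1 z.2 * M z.2
  upper : ∀ θ, (E.trueDensity z.1 z.2 : ℝ) ≤ E.modelDensity θ z.1 z.2 * M z.2

variable {E} {M : Y → ℝ} {z : A × Y}

theorem IsRegular.modelDensity_pos [TopologicalSpace Θ] (h : E.IsRegular M z) (θ : Θ) :
    0 < E.modelDensity θ z.1 z.2 := by
  by_contra! h0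
  have h1 : E.modelDensity θ z.1 z.2 = 0 := le_antisymm h0 bot_le
  have h2 := h.upper θ
  have h3 : (0 : ℝ) < E.trueDensity z.1 z.2 := by exact_mod_cast h.pos
  rw [h1, NNReal.coe_zero, zero_mul] at h2
  exact absurd h2 (not_le.2 h3)

theorem IsRegular.abs_logRatio_le [TopologicalSpace Θ] (h : E.IsRegular M z) (θ : Θ) :
    |E.logRatio θ z| ≤ Real.log (M z.2) := by
  have hq : (0 : ℝ) < E.trueDensity z.1 z.2 := by exact_mod_cast h.pos
  have hm : (0 : ℝ) < E.modelDensity θ z.1 z.2 := by exact_mod_cast h.modelDensity_pos θ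
  have hM : 0 < M z.2 := zero_lt_one.trans_le h.one_le
  rw [abs_le, logRatio]
  constructor
  · rw [← Real.log_inv]
    refine Real.log_le_log (by positivity) ?_
    rw [le_div_iff₀ hm, inv_mul_le_iff₀ hM, mul_comm]
    exact h.lower θ
  · refine Real.log_le_log (by positivity) ?_
    rw [div_le_iff₀ hm, mul_comm]
    exact h.upper θ

theorem IsRegular.continuous_logRatio [TopologicalSpace Θ] (h : E.IsRegular M z) :
    Continuous fun θ => E.logRatio θ z := by
  have hq : (0 : ℝ) < E.trueDensity z.1 z.2 := by exact_mod_cast h.pos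
  have hm : ∀ θ, (0 : ℝ) < E.modelDensity θ z.1 z.2 := fun θ => by
    exact_mod_cast h.modelDensity_pos θ
  refine Continuous.log (continuous_const.div (NNReal.continuous_coe.comp h.continuous)
    fun θ => (hm θ).ne') fun θ => (div_pos hq (hm θ)).ne'

theorem IsRegular.abs_logRatio_sub_le [TopologicalSpace Θ] (h : E.IsRegular M z) (θ θ' : Θ) :
    |E.logRatio θ z - E.logRatio θ' z| ≤ 2 * Real.log (M z.2) := by
  have h1 := h.abs_logRatio_le θ
  have h2 := h.abs_logRatio_le θ'
  rw [abs_le] at *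
  constructor <;> linarith

variable [PseudoMetricSpace Θ] [CompactSpace Θ] [Nonempty Θ]

variable (E) in
/-- The modulus of continuity of the log-likelihood ratio at scale `1 / (k + 1)`, along a dense
sequence of parameters. -/
noncomputable def oscillation (k : ℕ) (z : A × Y) : ℝ :=
  ⨆ p : {p : ℕ × ℕ // dist (TopologicalSpace.denseSeq Θ p.1) (TopologicalSpace.denseSeq Θ p.2)
    < 1 / ((k : ℝ) + 1)},
    |E.logRatio (TopologicalSpace.denseSeq Θ p.1.1) z
      - E.logRatio (TopologicalSpace.denseSeq Θ p.1.2) z|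

-- The supremum over pairs from a dense sequence is countable, hence measurable; a supremum over all
-- pairs of parameters would not be so evidently.
variable (E) in
theorem measurable_oscillation (k : ℕ) : Measurable (E.oscillation k) :=
  Measurable.iSup fun _ => continuous_abs.measurable.comp
    ((E.measurable_logRatio _).sub (E.measurable_logRatio _))

instance (k : ℕ) : Nonempty {p : ℕ × ℕ //
    dist (TopologicalSpace.denseSeq Θ p.1) (TopologicalSpace.denseSeq Θ p.2)
      < 1 / ((k : ℝ) + 1)} :=
  ⟨⟨(0, 0), by rw [dist_self]; positivity⟩⟩

variable (E) in
theorem oscillation_nonneg (k : ℕ) (z : A × Y) : 0 ≤ E.oscillation k z :=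
  Real.iSup_nonneg fun _ => abs_nonneg _

theorem IsRegular.oscillation_le (h : E.IsRegular M z) (k : ℕ) :
    E.oscillation k z ≤ 2 * Real.log (M z.2) :=
  ciSup_le fun _ => h.abs_logRatio_sub_le _ _

/-- Pairs at distance below the scale form an open set, in which the pairs from the dense sequence
are dense; the inequality is closed in the pair. -/
theorem IsRegular.abs_logRatio_sub_le_oscillation (h : E.IsRegular M z) {k : ℕ} {θ θ' : Θ}
    (hd : dist θ θ' < 1 / ((k : ℝ) + 1)) :
    |E.logRatio θ z - E.logRatio θ' z| ≤ E.oscillation k z := by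
  have hcont : Continuous fun p : Θ × Θ => |E.logRatio p.1 z - E.logRatio p.2 z| :=
    ((h.continuous_logRatio.comp continuous_fst).sub
      (h.continuous_logRatio.comp continuous_snd)).abs
  have hopen : IsOpen {p : Θ × Θ | dist p.1 p.2 < 1 / ((k : ℝ) + 1)} :=
    isOpen_lt continuous_dist continuous_const
  have hdense : Dense (Set.range (Prod.map (TopologicalSpace.denseSeq Θ)
      (TopologicalSpace.denseSeq Θ))) :=
    (TopologicalSpace.denseRange_denseSeq Θ).prodMap (TopologicalSpace.denseRange_denseSeq Θ)
  have hclosed : IsClosed {p : Θ × Θ | |E.logRatio p.1 z - E.logRatio p.2 z|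
      ≤ E.oscillation k z} := isClosed_le hcont continuous_const
  have hmem : (θ, θ') ∈ closure _ := hdense.open_subset_closure_inter hopen hd
  refine closure_minimal ?_ hclosed hmem
  rintro _ ⟨hp, ⟨i, j⟩, rfl⟩
  refine le_ciSup (f := fun p : {p : ℕ × ℕ // dist (TopologicalSpace.denseSeq Θ p.1)
    (TopologicalSpace.denseSeq Θ p.2) < 1 / ((k : ℝ) + 1)} =>
    |E.logRatio (TopologicalSpace.denseSeq Θ p.1.1) z
      - E.logRatio (TopologicalSpace.denseSeq Θ p.1.2) z|)
    -- Boundedness is essential here: a real supremum over an unbounded family is `0` by default.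
    ⟨2 * Real.log (M z.2), ?_⟩ ⟨(i, j), hp⟩
  rintro _ ⟨p, rfl⟩
  exact h.abs_logRatio_sub_le _ _

theorem IsRegular.tendsto_oscillation (h : E.IsRegular M z) :
    Tendsto (fun k => E.oscillation k z) atTop (𝓝 0) := by
  rw [Metric.tendsto_atTop]
  intro ε hε
  obtain ⟨δ, hδ, huc⟩ := Metric.uniformContinuous_iff.1
    (CompactSpace.uniformContinuous_of_continuous h.continuous_logRatio) (ε / 2) (half_pos hε)
  obtain ⟨N, hN⟩ := exists_nat_one_div_lt hδ
  refine ⟨N, fun k hk => ?_⟩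
  rw [Real.dist_eq, sub_zero, abs_of_nonneg (E.oscillation_nonneg k z)]
  refine lt_of_le_of_lt (ciSup_le fun p => ?_) (half_lt_self hε)
  refine (huc (lt_of_lt_of_le p.2 ?_)).le
  exact (Nat.one_div_le_one_div hk).trans hN.le

end Pathwise

/-! ### Moment bounds from the envelope -/

section Integrals

variable {A Θ Y : Type*} [MeasurableSpace A] [MeasurableSpace Θ] [MeasurableSpace Y]
  {E : LearningProblem A Θ Y} {M : Y → ℝ}

/-- Integrability of `M` alone gives second moments, because a logarithm is small against a square
root: `log M ≤ 2 √M`, hence `f ^ 2 ≤ 16 M`. -/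
theorem memLp_two_of_abs_le_log [TopologicalSpace Θ] {f : A × Y → ℝ} (hf : Measurable f)
    (hreg : ∀ a, ∀ᵐ y ∂E.trueKernel a, E.IsRegular M (a, y))
    (hint : ∀ a, Integrable M (E.trueKernel a))
    (hfM : ∀ z, E.IsRegular M z → |f z| ≤ 2 * Real.log (M z.2)) (a : A) :
    MemLp (fun y => f (a, y)) 2 (E.trueKernel a) := by
  have hm : Measurable fun y => f (a, y) := hf.comp (measurable_const.prodMk measurable_id)
  rw [memLp_two_iff_integrable_sq hm.aestronglyMeasurable]
  refine ((hint a).const_mul 16).mono' (hm.pow_const 2).aestronglyMeasurable ?_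
  filter_upwards [hreg a] with y hy
  have h1 := hfM _ hy
  have hM0 : 0 < M y := zero_lt_one.trans_le hy.one_le
  have h2 : Real.log (M y) ≤ 2 * √(M y) := by
    have := Real.log_le_sub_one_of_pos (Real.sqrt_pos.2 hM0)
    rw [Real.log_sqrt hM0.le] at this
    linarith
  have h3 : |f (a, y)| ≤ 4 * √(M y) := by
    simp only at h1
    linarith
  rw [Real.norm_eq_abs, abs_pow, sq_abs, ← sq_abs]
  calc |f (a, y)| ^ 2 ≤ (4 * √(M y)) ^ 2 := pow_le_pow_left₀ (abs_nonneg _) h3 2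
    _ = 16 * M y := by rw [mul_pow, Real.sq_sqrt hM0.le]; norm_num

theorem tendsto_trueMean_oscillation [PseudoMetricSpace Θ] [CompactSpace Θ] [Nonempty Θ]
    (hreg : ∀ a, ∀ᵐ y ∂E.trueKernel a, E.IsRegular M (a, y))
    (hint : ∀ a, Integrable M (E.trueKernel a)) (a : A) :
    Tendsto (fun k => E.trueMean (E.oscillation k) a) atTop (𝓝 0) := by
  have h0 : (0 : ℝ) = ∫ _, (0 : ℝ) ∂E.trueKernel a := by simp
  rw [h0]
  refine tendsto_integral_of_dominated_convergence (fun y => 2 * M y)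
    (fun k => ((E.measurable_oscillation k).comp
      (measurable_const.prodMk measurable_id)).aestronglyMeasurable) ((hint a).const_mul 2)
    (fun k => ?_) ?_
  · filter_upwards [hreg a] with y hy
    rw [Real.norm_eq_abs, abs_of_nonneg (E.oscillation_nonneg k _)]
    have h1 := Real.log_le_sub_one_of_pos (zero_lt_one.trans_le hy.one_le)
    have h2 := hy.oscillation_le k
    simp only at h1 h2
    linarith
  · filter_upwards [hreg a] with y hy using hy.tendsto_oscillation

end Integrals

/-! ### Consequences of the standing assumptions -/

section Assumptions

variable {A Θ Y : Type*} [MeasurableSpace A] [MeasurableSpace Θ] [MeasurableSpace Y]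
  [TopologicalSpace A] [TopologicalSpace Θ] {E : LearningProblem A Θ Y}

/-- The envelope holds off a null set that may depend on the parameter. Imposing it on a dense
sequence costs one null set, and continuity of the likelihood extends it to every parameter. Points
of zero true density are null under the true law, and `M q ≤ M r` makes `M` integrable. -/
theorem StandingAssumptions.exists_regular [TopologicalSpace.SeparableSpace Θ] [Nonempty Θ]
    (hE : E.StandingAssumptions) :
    ∃ M : Y → ℝ, (∀ a, ∀ᵐ y ∂E.trueKernel a, E.IsRegular M (a, y)) ∧
      ∀ a, Integrable M (E.trueKernel a) := by
  obtain ⟨M, r, h, hM, -, hM1, hr0, -, hb, hMr, -, -⟩ := hE.envelope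
  refine ⟨M, fun a => ?_, fun a => ?_⟩
  · have hq : Measurable (E.trueDensity a) :=
      E.measurable_trueDensity.comp (measurable_const.prodMk measurable_id)
    rw [E.trueKernel_eq a, ae_withDensity_iff hq.coe_nnreal_ennreal]
    have hb' : ∀ᵐ y ∂E.dominating, ∀ n, _ :=
      ae_all_iff.2 fun n => hb (TopologicalSpace.denseSeq Θ n) a
    filter_upwards [hb', hE.continuous_modelDensity] with y hy hc hpos
    have hc' : Continuous fun θ => E.modelDensity θ a y :=
      hc.comp (continuous_id.prodMk continuous_const)
    have hcr : Continuous fun θ => (E.modelDensity θ a y : ℝ) := NNReal.continuous_coe.comp hc'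
    have hd := TopologicalSpace.denseRange_denseSeq Θ
    have hM0 : 0 < M y := zero_lt_one.trans_le (hM1 y)
    refine ⟨pos_iff_ne_zero.2 (by simpa using hpos), hM1 y, hc', fun θ => ?_, fun θ => ?_⟩
    · refine hd.induction_on (p := fun θ => (E.modelDensity θ a y : ℝ) ≤ E.trueDensity a y * M y)
        θ (isClosed_le hcr continuous_const) fun n => ?_
      exact (mul_inv_le_iff₀ hM0).1 (hy n).1
    · exact hd.induction_on (p := fun θ => (E.trueDensity a y : ℝ) ≤ E.modelDensity θ a y * M y)
        θ (isClosed_le continuous_const (hcr.mul continuous_const)) fun n => (hy n).2.1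
  · have hq : Measurable (E.trueDensity a) :=
      E.measurable_trueDensity.comp (measurable_const.prodMk measurable_id)
    rw [E.trueKernel_eq a, integrable_withDensity_iff_integrable_smul hq]
    refine hMr.mono' (hq.coe_nnreal_real.mul hM).aestronglyMeasurable ?_
    filter_upwards [hb (Classical.arbitrary Θ) a] with y hy
    have hM0 : 0 ≤ M y := zero_le_one.trans (hM1 y)
    rw [NNReal.smul_def, smul_eq_mul, Real.norm_eq_abs, abs_of_nonneg (by positivity), mul_comm]
    exact mul_le_mul_of_nonneg_left hy.2.2 hM0

/-- Dominated convergence: `q_θ ≤ M q ≤ M r`, so the integrand is at most `h M r` in absolute value.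
-/
theorem StandingAssumptions.continuous_expectedPayoff [FirstCountableTopology Θ]
    (hE : E.StandingAssumptions) (a : A) : Continuous (E.expectedPayoff a) := by
  obtain ⟨M, r, h, hM, -, hM1, hr0, hh0, hb, -, hπ, hint⟩ := hE.envelope
  have hp : Measurable (E.payoff a) :=
    E.measurable_payoff.comp (measurable_const.prodMk measurable_id)
  have hq : ∀ θ, Measurable (E.modelDensity θ a) := fun θ =>
    E.measurable_modelDensity.comp
      (measurable_const.prodMk (measurable_const.prodMk measurable_id))
  have : E.expectedPayoff a = fun θ => ∫ y, E.payoff a y * E.modelDensity θ a y ∂E.dominating :=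
    funext fun θ => E.integral_modelKernel θ a _
  rw [this]
  refine continuous_of_dominated
    (fun θ => (hp.mul (hq θ).coe_nnreal_real).aestronglyMeasurable) (fun θ => ?_) hint ?_
  · filter_upwards [hb θ a, hπ a] with y hy hπy
    have hM0 : 0 < M y := zero_lt_one.trans_le (hM1 y)
    have h1 : (E.modelDensity θ a y : ℝ) ≤ r y * M y := by
      have := (mul_inv_le_iff₀ hM0).1 hy.1
      exact this.trans (mul_le_mul_of_nonneg_right hy.2.2 hM0.le)
    rw [norm_mul, Real.norm_eq_abs, NNReal.norm_eq]
    calc |E.payoff a y| * (E.modelDensity θ a y : ℝ) ≤ h y * (r y * M y) :=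
          mul_le_mul hπy h1 (NNReal.coe_nonneg _) (hh0 y)
      _ = h y * M y * r y := by ring
  · filter_upwards [hE.continuous_modelDensity] with y hy
    exact continuous_const.mul (NNReal.continuous_coe.comp
      (hy.comp (continuous_id.prodMk continuous_const)))

end Assumptions

/-! ### Almost sure properties of the path of play -/

section PathLaw

variable {A Θ Y : Type*} [MeasurableSpace A] [MeasurableSpace Θ] [MeasurableSpace Y]
  {E : LearningProblem A Θ Y} [Finite A] [DiscreteMeasurableSpace A] {μ₀ : ProbabilityMeasure Θ}
  {φ : ℕ → Kernel (ProbabilityMeasure Θ) A} [∀ t, IsMarkovKernel (φ t)]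

theorem ae_pathLaw_of_forall_ae {p : A × Y → Prop} (h : ∀ a, ∀ᵐ y ∂E.trueKernel a, p (a, y)) :
    ∀ᵐ ω ∂E.pathLaw μ₀ φ, ∀ n, p (ω n) := by
  -- The property `p` need not be measurable, so it is replaced by a measurable set of full measure
  -- inside it, one action at a time.
  have hG : ∀ a, ∃ s : Set Y, MeasurableSet s ∧ s ⊆ {y | p (a, y)} ∧ ∀ᵐ y ∂E.trueKernel a, y ∈ s :=
    fun a => by
      obtain ⟨s, h1, h2, h3⟩ := (h a).exists_measurable_mem
      exact ⟨s, h2, h3, h1⟩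
  choose s hs hsp hsae using hG
  set G : Set (A × Y) := ⋃ a, {a} ×ˢ s a with hGdef
  have hGm : MeasurableSet G := MeasurableSet.iUnion fun a =>
    (MeasurableSet.of_discrete (s := ({a} : Set A))).prod (hs a)
  have hGp : ∀ z ∈ G, p z := by
    rintro ⟨a, y⟩ hz
    obtain ⟨b, hb⟩ := Set.mem_iUnion.1 hz
    obtain ⟨rfl, hy⟩ := hb
    exact hsp _ hy
  have hper : ∀ (t : ℕ) (μ : ProbabilityMeasure Θ), ∀ᵐ z ∂E.periodKernel (φ t) μ, z ∈ G := by
    intro t μ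
    refine (Kernel.ae_compProd_iff (p := fun z => z ∈ G) hGm).2 (Eventually.of_forall fun a => ?_)
    filter_upwards [hsae a] with y hy
    exact Set.mem_iUnion.2 ⟨a, rfl, hy⟩
  rw [ae_all_iff]
  intro n
  suffices ∀ᵐ ω ∂E.pathLaw μ₀ φ, ω n ∈ G from this.mono fun ω hω => hGp _ hω
  cases n with
  | zero =>
    have h0 := hper 0 μ₀
    rw [← Kernel.map_eval_zero_trajMeasure (X := fun _ => A × Y) (μ₀ := E.periodKernel (φ 0) μ₀)
      (κ := fun n => (E.periodKernel (φ (n + 1))).comap (E.posterior μ₀ n)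
        (E.measurable_posterior μ₀ n))] at h0
    exact ae_of_ae_map (measurable_pi_apply 0).aemeasurable h0
  | succ n =>
    exact Kernel.ae_trajMeasure_succ (X := fun _ => A × Y) (p := fun x => x.2 ∈ G)
      (measurable_snd hGm) fun x => by
        rw [Kernel.comap_apply]
        exact hper (n + 1) _

theorem measurableSet_optimalActions (hU : ∀ a, StronglyMeasurable (E.expectedPayoff a)) :
    MeasurableSet {p : ProbabilityMeasure Θ × A | p.2 ∈ E.optimalActions p.1} := by
  let κ : Kernel (ProbabilityMeasure Θ) Θ := ⟨fun p => (p : Measure Θ), measurable_subtype_coe⟩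
  have hI : ∀ a, Measurable fun μ : ProbabilityMeasure Θ =>
      ∫ θ, E.expectedPayoff a θ ∂(μ : Measure Θ) := fun a =>
    (StronglyMeasurable.integral_kernel (κ := κ) (hU a)).measurable
  have hset : {p : ProbabilityMeasure Θ × A | p.2 ∈ E.optimalActions p.1} =
      ⋃ a, {μ | a ∈ E.optimalActions μ} ×ˢ {a} := by
    ext ⟨μ, a⟩
    simp
  rw [hset]
  refine MeasurableSet.iUnion fun a => MeasurableSet.prod ?_ MeasurableSet.of_discrete
  have hset' : {μ | a ∈ E.optimalActions μ} = ⋂ a', {μ : ProbabilityMeasure Θ |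
      ∫ θ, E.expectedPayoff a' θ ∂(μ : Measure Θ)
        ≤ ∫ θ, E.expectedPayoff a θ ∂(μ : Measure Θ)} := by
    ext μ
    simp [optimalActions]
  rw [hset']
  exact MeasurableSet.iInter fun a' => measurableSet_le (hI a') (hI a)

/-- The initial action is left out: only the long run matters, and period `n + 1` pairs with the
posterior after periods `0, …, n`. -/
theorem ae_mem_optimalActions (hU : ∀ a, StronglyMeasurable (E.expectedPayoff a))
    (hφ : ∀ t μ, φ t μ (E.optimalActions μ) = 1) :
    ∀ᵐ ω ∂E.pathLaw μ₀ φ, ∀ n, (ω (n + 1)).1 ∈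
      E.optimalActions (E.posterior μ₀ n (Preorder.frestrictLe (π := fun _ => A × Y) n ω)) := by
  rw [ae_all_iff]
  intro n
  have hm : MeasurableSet {x : (Finset.Iic n → A × Y) × (A × Y) |
      x.2.1 ∈ E.optimalActions (E.posterior μ₀ n x.1)} :=
    (((E.measurable_posterior μ₀ n).comp measurable_fst).prodMk
      (measurable_fst.comp measurable_snd)) (measurableSet_optimalActions hU)
  refine Kernel.ae_trajMeasure_succ (X := fun _ => A × Y) hm fun x => ?_
  rw [Kernel.comap_apply]
  have hs : MeasurableSet (E.optimalActions (E.posterior μ₀ n x)) := MeasurableSet.of_discrete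
  refine (Kernel.ae_compProd_iff (p := fun z : A × Y =>
    z.1 ∈ E.optimalActions (E.posterior μ₀ n x)) (measurable_fst hs)).2 ?_
  have h1 : ∀ᵐ a ∂φ (n + 1) (E.posterior μ₀ n x), a ∈ E.optimalActions (E.posterior μ₀ n x) :=
    (prob_compl_eq_zero_iff hs).2 (hφ _ _)
  filter_upwards [h1] with a ha
  exact Eventually.of_forall fun _ => ha

/-- Centring at the mean given the action makes the conditional mean zero whatever the selection
rule, so no convergence of the actions is needed. -/
theorem ae_tendsto_average_sub_trueMean {f : A × Y → ℝ} (hf : Measurable f)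
    (hf2 : ∀ a, MemLp (fun y => f (a, y)) 2 (E.trueKernel a)) :
    ∀ᵐ ω ∂E.pathLaw μ₀ φ, Tendsto (fun n : ℕ => (n : ℝ)⁻¹ * ∑ i ∈ Finset.range n,
      (f (ω i) - E.trueMean f (ω i).1)) atTop (𝓝 0) := by
  have := Fintype.ofFinite A
  set g : A × Y → ℝ := fun z => f z - E.trueMean f z.1 with hg
  have hgm : Measurable g :=
    hf.sub ((Measurable.of_discrete (f := E.trueMean f)).comp measurable_fst)
  have hg2 : ∀ a, MemLp (fun y => g (a, y)) 2 (E.trueKernel a) := fun a =>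
    (hf2 a).sub (memLp_const (E.trueMean f a))
  have hfin : ∀ a, ∫⁻ y, ‖g (a, y)‖ₑ ^ 2 ∂E.trueKernel a ≠ ∞ := fun a => by
    have := (eLpNorm_lt_top_iff_lintegral_rpow_enorm_lt_top two_ne_zero
      ENNReal.ofNat_ne_top).1 (hg2 a).2
    simpa using this.ne
  let c : A → ℝ≥0 := fun a => (∫⁻ y, ‖g (a, y)‖ₑ ^ 2 ∂E.trueKernel a).toNNReal
  -- Finiteness of `A` makes the second-moment bound uniform over actions, hence over beliefs and
  -- periods.
  obtain ⟨C, hC⟩ : ∃ C : ℝ≥0, ∀ a, c a ≤ C :=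
    ⟨∑ a, c a, fun a => Finset.single_le_sum (fun _ _ => zero_le) (Finset.mem_univ a)⟩
  have hCa : ∀ a, ∫⁻ y, ‖g (a, y)‖ₑ ^ 2 ∂E.trueKernel a ≤ C := fun a => by
    rw [← ENNReal.coe_toNNReal (hfin a)]
    exact ENNReal.coe_le_coe.2 (hC a)
  have hsecond : ∀ (t : ℕ) (μ : ProbabilityMeasure Θ),
      ∫⁻ z, ‖g z‖ₑ ^ 2 ∂E.periodKernel (φ t) μ ≤ C := by
    intro t μ
    rw [periodKernel, Kernel.lintegral_compProd _ _ _ (hgm.enorm.pow_const 2)]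
    exact (lintegral_mono fun a => hCa a).trans (by simp)
  have hmean : ∀ (t : ℕ) (μ : ProbabilityMeasure Θ), ∫ z, g z ∂E.periodKernel (φ t) μ = 0 := by
    intro t μ
    have hint : Integrable g (E.periodKernel (φ t) μ) := by
      refine MemLp.integrable (q := 2) one_le_two ⟨hgm.aestronglyMeasurable, ?_⟩
      rw [eLpNorm_lt_top_iff_lintegral_rpow_enorm_lt_top two_ne_zero ENNReal.ofNat_ne_top]
      simpa using (hsecond t μ).trans_lt ENNReal.coe_lt_top
    rw [periodKernel] at hint ⊢
    rw [integral_compProd hint]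
    refine integral_eq_zero_of_ae (Eventually.of_forall fun a => ?_)
    change ∫ y, (f (a, y) - E.trueMean f a) ∂E.trueKernel a = 0
    rw [integral_sub ((hf2 a).integrable one_le_two) (integrable_const _)]
    simp [trueMean]
  have hsecond' : ∀ n x, ∫⁻ z, ‖g z‖ₑ ^ 2 ∂((E.periodKernel (φ (n + 1))).comap (E.posterior μ₀ n)
      (E.measurable_posterior μ₀ n)) x ≤ C := fun n x => by
    rw [Kernel.comap_apply]
    exact hsecond _ _
  have hmean' : ∀ n x, ∫ z, g z ∂((E.periodKernel (φ (n + 1))).comap (E.posterior μ₀ n)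
      (E.measurable_posterior μ₀ n)) x = 0 := fun n x => by
    rw [Kernel.comap_apply]
    exact hmean _ _
  have key := Kernel.ae_tendsto_average_zero_trajMeasure (μ₀ := E.periodKernel (φ 0) μ₀)
    (κ := fun n => (E.periodKernel (φ (n + 1))).comap (E.posterior μ₀ n)
      (E.measurable_posterior μ₀ n)) hgm (hsecond 0 μ₀) hsecond' hmean'
  exact key

end PathLaw

end MisspecifiedLearning.LearningProblem

/-! ### Concentration of exponential weights -/

/-- Laplace's principle: probability measures with densities proportional to `exp (-(n + 1) ℓ n)`,
where `ℓ n` converges uniformly to `L`, concentrate on the minimizers of `L`. -/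
theorem tendsto_measure_superlevel_of_exp_weights {Θ : Type*} [TopologicalSpace Θ]
    [MeasurableSpace Θ] [OpensMeasurableSpace Θ] {μ₀ : Measure Θ} [IsProbabilityMeasure μ₀]
    (hμ₀ : μ₀.support = Set.univ) {ν : ℕ → Measure Θ} [∀ n, IsProbabilityMeasure (ν n)]
    {c : ℕ → ℝ≥0∞} {p : ℕ → ℝ} (hp : ∀ n, 0 ≤ p n) {ℓ : ℕ → Θ → ℝ} {L : Θ → ℝ}
    (hν : ∀ n, ν n = c n • μ₀.withDensity fun θ =>
      ENNReal.ofReal (p n * Real.exp (-(((n : ℝ) + 1) * ℓ n θ))))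
    (hL : Continuous L) (hunif : TendstoUniformly ℓ L atTop) (θ₀ : Θ) {ε : ℝ} (hε : 0 < ε) :
    Tendsto (fun n => ν n {θ | L θ₀ + ε < L θ}) atTop (𝓝 0) := by
  -- Once `ℓ n` is within `δ` of `L`, it is below `L θ₀ + 2δ` on `V` and above `L θ₀ + 3δ` on `B`;
  -- the remaining gap `δ` gives the exponential decay.
  set δ : ℝ := ε / 4 with hδdef
  have hδ : 0 < δ := by positivity
  set B : Set Θ := {θ | L θ₀ + ε < L θ} with hB
  set V : Set Θ := {θ | L θ < L θ₀ + δ} with hV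
  have hBo : IsOpen B := isOpen_lt continuous_const hL
  have hVo : IsOpen V := isOpen_lt hL continuous_const
  have hVpos : 0 < μ₀ V := by
    have hmem : θ₀ ∈ μ₀.support := hμ₀ ▸ Set.mem_univ θ₀
    refine (Measure.mem_support_iff_forall θ₀).1 hmem V (hVo.mem_nhds ?_)
    simp [hV, hδ]
  -- A lower bound for the density on `V`. Since `V` has mass at most one, `T n ≤ (μ₀ V)⁻¹`, so
  -- nothing need be known about the normalizers `c n`.
  set T : ℕ → ℝ≥0∞ := fun n =>
    c n * ENNReal.ofReal (p n * Real.exp (-(((n : ℝ) + 1) * (L θ₀ + 2 * δ)))) with hT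
  have hbound : ∀ᶠ n in atTop, ν n B ≤
      (μ₀ V)⁻¹ * ENNReal.ofReal (Real.exp (-(((n : ℝ) + 1) * δ))) := by
    filter_upwards [Metric.tendstoUniformly_iff.1 hunif δ hδ] with n hn
    have hclose : ∀ θ, |L θ - ℓ n θ| < δ := hn
    have hn1 : (0 : ℝ) < (n : ℝ) + 1 := by positivity
    have h1 : T n * μ₀ V ≤ 1 := by
      calc T n * μ₀ V
          = c n * ∫⁻ _ in V, ENNReal.ofReal (p n *
              Real.exp (-(((n : ℝ) + 1) * (L θ₀ + 2 * δ)))) ∂μ₀ := by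
            rw [setLIntegral_const, hT, mul_assoc]
        _ ≤ c n * ∫⁻ θ in V, ENNReal.ofReal (p n *
              Real.exp (-(((n : ℝ) + 1) * ℓ n θ))) ∂μ₀ := by
            refine mul_le_mul_right (setLIntegral_mono' hVo.measurableSet fun θ hθ => ?_) _
            refine ENNReal.ofReal_le_ofReal (mul_le_mul_of_nonneg_left
              (Real.exp_le_exp.2 (neg_le_neg (mul_le_mul_of_nonneg_left ?_ hn1.le))) (hp n))
            have := abs_lt.1 (hclose θ)
            have hθ' : L θ < L θ₀ + δ := hθ
            linarith
        _ = ν n V := by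
            rw [hν n, Measure.smul_apply, withDensity_apply _ hVo.measurableSet, smul_eq_mul]
        _ ≤ 1 := prob_le_one
    have h2 : T n ≤ (μ₀ V)⁻¹ := ENNReal.le_inv_iff_mul_le.2 h1
    calc ν n B = c n * ∫⁻ θ in B, ENNReal.ofReal (p n *
              Real.exp (-(((n : ℝ) + 1) * ℓ n θ))) ∂μ₀ := by
            rw [hν n, Measure.smul_apply, withDensity_apply _ hBo.measurableSet, smul_eq_mul]
      _ ≤ c n * ∫⁻ _ in B, ENNReal.ofReal (p n *
              Real.exp (-(((n : ℝ) + 1) * (L θ₀ + 3 * δ)))) ∂μ₀ := by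
            refine mul_le_mul_right (setLIntegral_mono' hBo.measurableSet fun θ hθ => ?_) _
            refine ENNReal.ofReal_le_ofReal (mul_le_mul_of_nonneg_left
              (Real.exp_le_exp.2 (neg_le_neg (mul_le_mul_of_nonneg_left ?_ hn1.le))) (hp n))
            have := abs_lt.1 (hclose θ)
            have hθ' : L θ₀ + ε < L θ := hθ
            linarith
      _ ≤ c n * ENNReal.ofReal (p n * Real.exp (-(((n : ℝ) + 1) * (L θ₀ + 3 * δ)))) := by
            rw [setLIntegral_const]
            exact mul_le_mul_right (mul_le_of_le_one_right' prob_le_one) _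
      _ = T n * ENNReal.ofReal (Real.exp (-(((n : ℝ) + 1) * δ))) := by
            rw [hT]
            simp only
            rw [mul_assoc, ← ENNReal.ofReal_mul (mul_nonneg (hp n) (Real.exp_nonneg _)),
              mul_assoc (p n), ← Real.exp_add]
            ring_nf
      _ ≤ _ := mul_le_mul_left h2 _
  have hlim : Tendsto (fun n : ℕ =>
      (μ₀ V)⁻¹ * ENNReal.ofReal (Real.exp (-(((n : ℝ) + 1) * δ)))) atTop (𝓝 0) := by
    have h1 : Tendsto (fun n : ℕ => Real.exp (-(((n : ℝ) + 1) * δ))) atTop (𝓝 0) := by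
      refine Real.tendsto_exp_neg_atTop_nhds_zero.comp ?_
      exact (tendsto_atTop_add_const_right _ _ tendsto_natCast_atTop_atTop).atTop_mul_const hδ
    have h2 := ENNReal.tendsto_ofReal h1
    rw [ENNReal.ofReal_zero] at h2
    simpa using ENNReal.Tendsto.const_mul h2 (Or.inr (ENNReal.inv_ne_top.2 hVpos.ne'))
  exact tendsto_of_tendsto_of_tendsto_of_le_of_le' tendsto_const_nhds hlim
    (Eventually.of_forall fun _ => zero_le) hbound

theorem continuous_of_abs_sub_le_modulus {Θ : Type*} [PseudoMetricSpace Θ] {L : Θ → ℝ} {W : ℕ → ℝ}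
    (hW : Tendsto W atTop (𝓝 0))
    (hLW : ∀ (k : ℕ) θ θ', dist θ θ' < 1 / ((k : ℝ) + 1) → |L θ - L θ'| ≤ W k) : Continuous L := by
  rw [Metric.continuous_iff]
  intro θ ε hε
  obtain ⟨k, hk⟩ := (hW.eventually_lt_const hε).exists
  exact ⟨1 / ((k : ℝ) + 1), by positivity, fun θ' hd => (hLW k θ' θ hd).trans_lt hk⟩

/-! ### Limits of empirical distributions -/

namespace MisspecifiedLearning

theorem integral_empiricalDistribution {A : Type*} [MeasurableSpace A] [Finite A]
    [DiscreteMeasurableSpace A] (x : ℕ → A) (n : ℕ) (f : A → ℝ) :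
    ∫ a, f a ∂(empiricalDistribution x n : Measure A) =
      ((n : ℝ) + 1)⁻¹ * ∑ i ∈ Finset.range (n + 1), f (x i) := by
  change ∫ a, f a ∂(((n : ℝ≥0∞) + 1)⁻¹ • ∑ i ∈ Finset.range (n + 1), Measure.dirac (x i)) = _
  rw [integral_smul_measure, integral_finsetSum_measure fun i _ => Integrable.of_finite]
  simp only [integral_dirac, smul_eq_mul, ENNReal.toReal_inv]
  rw [ENNReal.toReal_add (by simp) (by simp)]
  simp

theorem tendsto_average_of_tendsto_empiricalDistribution {A : Type*} [MeasurableSpace A] [Finite A]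
    [DiscreteMeasurableSpace A] [TopologicalSpace A] [DiscreteTopology A] {x : ℕ → A}
    {σ : ProbabilityMeasure A} (h : Tendsto (empiricalDistribution x) atTop (𝓝 σ)) (f : A → ℝ) :
    Tendsto (fun n : ℕ => ((n : ℝ) + 1)⁻¹ * ∑ i ∈ Finset.range (n + 1), f (x i)) atTop
      (𝓝 (∫ a, f a ∂(σ : Measure A))) := by
  have := ProbabilityMeasure.tendsto_iff_forall_integral_tendsto.1 h
    (BoundedContinuousFunction.mkOfCompact ⟨f, continuous_of_discreteTopology⟩)
  simpa [integral_empiricalDistribution] using this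

/-- Every action in the support of a limit of empirical distributions recurs. -/
theorem frequently_eq_of_mem_support {A : Type*} [MeasurableSpace A] [Finite A]
    [DiscreteMeasurableSpace A] [TopologicalSpace A] [DiscreteTopology A] {x : ℕ → A}
    {σ : ProbabilityMeasure A} (h : Tendsto (empiricalDistribution x) atTop (𝓝 σ)) {a : A}
    (ha : a ∈ (σ : Measure A).support) : ∃ᶠ n in atTop, x n = a := by
  -- If `a` were eventually never played, its empirical frequency would tend to zero, so `σ` would
  -- give `{a}`, a neighbourhood of `a`, no mass.
  intro hne
  have h1 := tendsto_average_of_tendsto_empiricalDistribution h (Set.indicator {a} 1)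
  have h2 : Tendsto (fun n => Set.indicator {a} (1 : A → ℝ) (x n)) atTop (𝓝 0) := by
    refine tendsto_const_nhds.congr' ?_
    filter_upwards [hne] with n hn
    simp [hn]
  have h3 := (tendsto_add_atTop_iff_nat 1).2 h2.cesaro
  have h4 : ∫ b, Set.indicator {a} (1 : A → ℝ) b ∂(σ : Measure A) = 0 := by
    refine tendsto_nhds_unique h1 ?_
    simpa using h3
  rw [integral_indicator_one MeasurableSet.of_discrete, measureReal_eq_zero_iff] at h4
  have h5 := (Measure.mem_support_iff_forall a).1 ha {a} (mem_nhds_discrete.2 rfl)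
  exact h5.ne' h4

namespace LearningProblem

variable {A Θ Y : Type*} [MeasurableSpace A] [MeasurableSpace Θ] [MeasurableSpace Y]
  {E : LearningProblem A Θ Y} {M : Y → ℝ}

/-! ### The posterior as an exponentially weighted prior -/

section Posterior

variable [TopologicalSpace Θ]

/-- At a regular observation the evidence lies between `q / M` and `q M`, so the default branch of
the update is never taken. -/
theorem IsRegular.coe_bayesUpdate {z : A × Y} (h : E.IsRegular M z) (μ : ProbabilityMeasure Θ) :
    (E.bayesUpdate μ z : Measure Θ) = (E.evidence μ z)⁻¹ •
      (μ : Measure Θ).withDensity fun θ => (E.modelDensity θ z.1 z.2 : ℝ≥0∞) := by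
  have hM : 0 < M z.2 := zero_lt_one.trans_le h.one_le
  have hq : (0 : ℝ) < E.trueDensity z.1 z.2 := by exact_mod_cast h.pos
  have hlow : ENNReal.ofReal (E.trueDensity z.1 z.2 / M z.2) ≤ E.evidence μ z := by
    calc ENNReal.ofReal (E.trueDensity z.1 z.2 / M z.2)
        = ∫⁻ _, ENNReal.ofReal (E.trueDensity z.1 z.2 / M z.2) ∂(μ : Measure Θ) := by simp
      _ ≤ E.evidence μ z := lintegral_mono fun θ => by
          rw [← ENNReal.ofReal_coe_nnreal]
          exact ENNReal.ofReal_le_ofReal ((div_le_iff₀ hM).2 (h.upper θ))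
  have hup : E.evidence μ z ≤ ENNReal.ofReal (E.trueDensity z.1 z.2 * M z.2) := by
    calc E.evidence μ z
        ≤ ∫⁻ _, ENNReal.ofReal (E.trueDensity z.1 z.2 * M z.2) ∂(μ : Measure Θ) :=
          lintegral_mono fun θ => by
            rw [← ENNReal.ofReal_coe_nnreal]
            exact ENNReal.ofReal_le_ofReal (h.lower θ)
      _ = _ := by simp
  have hne : E.evidence μ z ≠ 0 ∧ E.evidence μ z ≠ ∞ :=
    ⟨((ENNReal.ofReal_pos.2 (div_pos hq hM)).trans_le hlow).ne',
      (hup.trans_lt ENNReal.ofReal_lt_top).ne⟩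
  change E.bayesMeasure μ z = _
  rw [bayesMeasure, if_pos hne]

theorem exists_posterior_eq {ω : ℕ → A × Y} (hω : ∀ n, E.IsRegular M (ω n))
    (μ₀ : ProbabilityMeasure Θ) (n : ℕ) : ∃ c : ℝ≥0∞,
    (E.posterior μ₀ n (Preorder.frestrictLe (π := fun _ => A × Y) n ω) : Measure Θ) =
      c • (μ₀ : Measure Θ).withDensity fun θ =>
        ∏ i ∈ Finset.range (n + 1), (E.modelDensity θ (ω i).1 (ω i).2 : ℝ≥0∞) := by
  have hm : ∀ i, Measurable fun θ => (E.modelDensity θ (ω i).1 (ω i).2 : ℝ≥0∞) := fun i =>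
    (E.measurable_modelDensity.comp
      (measurable_id.prodMk measurable_const)).coe_nnreal_ennreal
  induction n with
  | zero =>
    refine ⟨(E.evidence μ₀ (ω 0))⁻¹, ?_⟩
    simp only [zero_add, Finset.range_one, Finset.prod_singleton]
    exact (hω 0).coe_bayesUpdate μ₀
  | succ n ih =>
    obtain ⟨c, hc⟩ := ih
    have h1 := (hω (n + 1)).coe_bayesUpdate
      (E.posterior μ₀ n (Preorder.frestrictLe (π := fun _ => A × Y) n ω))
    have hprod : (fun θ => ∏ i ∈ Finset.range (n + 1 + 1),
        (E.modelDensity θ (ω i).1 (ω i).2 : ℝ≥0∞)) =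
        (fun θ => ∏ i ∈ Finset.range (n + 1), (E.modelDensity θ (ω i).1 (ω i).2 : ℝ≥0∞)) *
          fun θ => (E.modelDensity θ (ω (n + 1)).1 (ω (n + 1)).2 : ℝ≥0∞) := by
      ext θ
      rw [Finset.prod_range_succ]
      rfl
    rw [hc, withDensity_smul_measure, smul_smul, ← withDensity_mul _
      (Finset.measurable_fun_prod _ fun i _ => hm i) (hm (n + 1)), ← hprod] at h1
    exact ⟨_, h1⟩

/-- Each factor is `q_θ = q exp (-log (q / q_θ))`. The product of true densities is free of the
parameter and serves as the prefactor `p n` in Laplace's principle. -/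
theorem prod_modelDensity {ω : ℕ → A × Y} (hω : ∀ n, E.IsRegular M (ω n)) (θ : Θ) (n : ℕ) :
    ∏ i ∈ Finset.range (n + 1), (E.modelDensity θ (ω i).1 (ω i).2 : ℝ≥0∞) =
      ENNReal.ofReal ((∏ i ∈ Finset.range (n + 1), (E.trueDensity (ω i).1 (ω i).2 : ℝ)) *
        Real.exp (-(((n : ℝ) + 1) *
          (((n : ℝ) + 1)⁻¹ * ∑ i ∈ Finset.range (n + 1), E.logRatio θ (ω i))))) := by
  have hn : (n : ℝ) + 1 ≠ 0 := by positivity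
  rw [mul_inv_cancel_left₀ hn, ← Finset.sum_neg_distrib, Real.exp_sum, ← Finset.prod_mul_distrib,
    ENNReal.ofReal_prod_of_nonneg fun i _ => by positivity]
  refine Finset.prod_congr rfl fun i _ => ?_
  have hq : (0 : ℝ) < E.trueDensity (ω i).1 (ω i).2 := by exact_mod_cast (hω i).pos
  have hm : (0 : ℝ) < E.modelDensity θ (ω i).1 (ω i).2 := by
    exact_mod_cast (hω i).modelDensity_pos θ
  rw [logRatio, ← Real.log_inv, Real.exp_log (by positivity), inv_div, mul_div_cancel₀ _ hq.ne',
    ENNReal.ofReal_coe_nnreal]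

theorem tendsto_posterior_superlevel [OpensMeasurableSpace Θ] {ω : ℕ → A × Y}
    (hω : ∀ n, E.IsRegular M (ω n)) {μ₀ : ProbabilityMeasure Θ}
    (hμ₀ : (μ₀ : Measure Θ).support = Set.univ) {L : Θ → ℝ} (hL : Continuous L)
    (hunif : TendstoUniformly (fun (n : ℕ) θ =>
      ((n : ℝ) + 1)⁻¹ * ∑ i ∈ Finset.range (n + 1), E.logRatio θ (ω i)) L atTop)
    (θ₀ : Θ) {ε : ℝ} (hε : 0 < ε) :
    Tendsto (fun n => (E.posterior μ₀ n (Preorder.frestrictLe (π := fun _ => A × Y) n ω) :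
      Measure Θ) {θ | L θ₀ + ε < L θ}) atTop (𝓝 0) := by
  choose c hc using exists_posterior_eq hω μ₀
  refine tendsto_measure_superlevel_of_exp_weights hμ₀ (c := c)
    (p := fun n => ∏ i ∈ Finset.range (n + 1), (E.trueDensity (ω i).1 (ω i).2 : ℝ))
    (fun n => Finset.prod_nonneg fun i _ => NNReal.coe_nonneg _) (fun n => ?_) hL hunif θ₀ hε
  rw [hc n]
  simp only [prod_modelDensity hω]

end Posterior

/-! ### Uniform convergence of the average log-likelihood ratio -/

section Uniform

variable [PseudoMetricSpace Θ] [CompactSpace Θ] [Nonempty Θ]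

/-- An `ε / 3` argument on a finite net from the dense sequence. `W k` controls the variation of `L`
at scale `k`, and as the limit of the average oscillations it eventually controls that of the
averages. -/
theorem tendstoUniformly_average_logRatio {ω : ℕ → A × Y} (hω : ∀ n, E.IsRegular M (ω n))
    {L : Θ → ℝ} {W : ℕ → ℝ} (hW : Tendsto W atTop (𝓝 0))
    (hLW : ∀ (k : ℕ) θ θ', dist θ θ' < 1 / ((k : ℝ) + 1) → |L θ - L θ'| ≤ W k)
    (hosc : ∀ k, Tendsto (fun n : ℕ =>
      ((n : ℝ) + 1)⁻¹ * ∑ i ∈ Finset.range (n + 1), E.oscillation k (ω i)) atTop (𝓝 (W k)))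
    (hlog : ∀ j, Tendsto (fun n : ℕ => ((n : ℝ) + 1)⁻¹ * ∑ i ∈ Finset.range (n + 1),
      E.logRatio (TopologicalSpace.denseSeq Θ j) (ω i)) atTop
      (𝓝 (L (TopologicalSpace.denseSeq Θ j)))) :
    TendstoUniformly (fun (n : ℕ) θ =>
      ((n : ℝ) + 1)⁻¹ * ∑ i ∈ Finset.range (n + 1), E.logRatio θ (ω i)) L atTop := by
  rw [Metric.tendstoUniformly_iff]
  intro ε hε
  obtain ⟨k, hk⟩ := (hW.eventually_lt_const (show 0 < ε / 3 by positivity)).exists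
  have hr : (0 : ℝ) < 1 / ((k : ℝ) + 1) := by positivity
  obtain ⟨J, hJ⟩ : ∃ J : Finset ℕ, ∀ θ : Θ, ∃ j ∈ J,
      dist θ (TopologicalSpace.denseSeq Θ j) < 1 / ((k : ℝ) + 1) := by
    obtain ⟨J, hJ⟩ := isCompact_univ.elim_finite_subcover
      (fun j => Metric.ball (TopologicalSpace.denseSeq Θ j) (1 / ((k : ℝ) + 1)))
      (fun _ => Metric.isOpen_ball) fun θ _ => by
        obtain ⟨_, hj, j, rfl⟩ :=
          Metric.dense_iff.1 (TopologicalSpace.denseRange_denseSeq Θ) θ _ hr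
        exact Set.mem_iUnion.2 ⟨j, Metric.mem_ball_comm.1 hj⟩
    refine ⟨J, fun θ => ?_⟩
    obtain ⟨j, hj⟩ := Set.mem_iUnion.1 (hJ (Set.mem_univ θ))
    obtain ⟨hjJ, hj⟩ := Set.mem_iUnion.1 hj
    exact ⟨j, hjJ, hj⟩
  have hfin : ∀ᶠ n : ℕ in atTop, ∀ j ∈ J, |((n : ℝ) + 1)⁻¹ * ∑ i ∈ Finset.range (n + 1),
      E.logRatio (TopologicalSpace.denseSeq Θ j) (ω i)
        - L (TopologicalSpace.denseSeq Θ j)| < ε / 3 :=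
    (Filter.eventually_all_finset J).2 fun j _ =>
      (Metric.tendsto_nhds.1 (hlog j) (ε / 3) (by positivity))
  filter_upwards [hfin, (hosc k).eventually_lt_const hk] with n hn hno θ
  obtain ⟨j, hj, hd⟩ := hJ θ
  have h1 := hn j hj
  have h2 := hLW k _ _ hd
  have h3 : |((n : ℝ) + 1)⁻¹ * ∑ i ∈ Finset.range (n + 1), E.logRatio θ (ω i) -
      ((n : ℝ) + 1)⁻¹ * ∑ i ∈ Finset.range (n + 1),
        E.logRatio (TopologicalSpace.denseSeq Θ j) (ω i)| ≤
      ((n : ℝ) + 1)⁻¹ * ∑ i ∈ Finset.range (n + 1), E.oscillation k (ω i) := by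
    have hn0 : (0 : ℝ) ≤ ((n : ℝ) + 1)⁻¹ := by positivity
    rw [← mul_sub, abs_mul, abs_of_nonneg hn0, ← Finset.sum_sub_distrib]
    refine mul_le_mul_of_nonneg_left ((Finset.abs_sum_le_sum_abs _ _).trans
      (Finset.sum_le_sum fun i _ => ?_)) hn0
    exact (hω i).abs_logRatio_sub_le_oscillation hd
  rw [Real.dist_eq]
  rw [abs_lt] at h1 ⊢
  rw [abs_le] at h2 h3
  constructor <;> linarith

end Uniform

end LearningProblem

end MisspecifiedLearning

/-! ### Passage to the limit and the equilibrium property -/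

namespace MisspecifiedLearning.LearningProblem

variable {A Θ Y : Type*} [MeasurableSpace A] [MeasurableSpace Θ] [MeasurableSpace Y]
  {E : LearningProblem A Θ Y} {M : Y → ℝ}

theorem tendsto_average_of_tendsto_sub_trueMean [Finite A] [DiscreteMeasurableSpace A]
    [TopologicalSpace A] [DiscreteTopology A] {ω : ℕ → A × Y} {σ : ProbabilityMeasure A}
    (hσ : Tendsto (empiricalDistribution fun t => (ω t).1) atTop (𝓝 σ)) {f : A × Y → ℝ}
    (hf : Tendsto (fun n : ℕ => (n : ℝ)⁻¹ * ∑ i ∈ Finset.range n,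
      (f (ω i) - E.trueMean f (ω i).1)) atTop (𝓝 0)) :
    Tendsto (fun n : ℕ => ((n : ℝ) + 1)⁻¹ * ∑ i ∈ Finset.range (n + 1), f (ω i)) atTop
      (𝓝 (∫ a, E.trueMean f a ∂(σ : Measure A))) := by
  have h1 := (tendsto_add_atTop_iff_nat 1).2 hf
  have h2 := h1.add (tendsto_average_of_tendsto_empiricalDistribution hσ (E.trueMean f))
  rw [zero_add] at h2
  refine h2.congr fun n => ?_
  rw [Finset.sum_sub_distrib]
  push_cast
  ring

theorem abs_klDivergence_sub_le [PseudoMetricSpace Θ] [CompactSpace Θ] [Nonempty Θ]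
    (hreg : ∀ a, ∀ᵐ y ∂E.trueKernel a, E.IsRegular M (a, y))
    (hint : ∀ a, Integrable M (E.trueKernel a)) {k : ℕ} {θ θ' : Θ}
    (hd : dist θ θ' < 1 / ((k : ℝ) + 1)) (a : A) :
    |E.klDivergence θ a - E.klDivergence θ' a| ≤ E.trueMean (E.oscillation k) a := by
  have hlog : ∀ θ, Integrable (fun y => E.logRatio θ (a, y)) (E.trueKernel a) := fun θ =>
    (memLp_two_of_abs_le_log (E.measurable_logRatio θ) hreg hint
      (fun z hz => by
        have h1 := hz.abs_logRatio_le θ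
        have h2 := abs_nonneg (E.logRatio θ z)
        linarith) a).integrable one_le_two
  have hosc : Integrable (fun y => E.oscillation k (a, y)) (E.trueKernel a) :=
    (memLp_two_of_abs_le_log (E.measurable_oscillation k) hreg hint
      (fun z hz => by
        rw [abs_of_nonneg (E.oscillation_nonneg k z)]
        exact hz.oscillation_le k) a).integrable one_le_two
  rw [← trueMean_logRatio, ← trueMean_logRatio, trueMean, trueMean,
    ← integral_sub (hlog θ) (hlog θ')]
  refine (abs_integral_le_integral_abs).trans
    (integral_mono_ae ((hlog θ).sub (hlog θ')).abs hosc ?_)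
  filter_upwards [hreg a] with y hy using hy.abs_logRatio_sub_le_oscillation hd

variable [Finite A] [DiscreteMeasurableSpace A]

theorem abs_integral_klDivergence_sub_le [PseudoMetricSpace Θ] [CompactSpace Θ] [Nonempty Θ]
    (hreg : ∀ a, ∀ᵐ y ∂E.trueKernel a, E.IsRegular M (a, y))
    (hint : ∀ a, Integrable M (E.trueKernel a)) (σ : ProbabilityMeasure A) {k : ℕ} {θ θ' : Θ}
    (hd : dist θ θ' < 1 / ((k : ℝ) + 1)) :
    |∫ a, E.klDivergence θ a ∂(σ : Measure A) - ∫ a, E.klDivergence θ' a ∂(σ : Measure A)| ≤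
      ∫ a, E.trueMean (E.oscillation k) a ∂(σ : Measure A) := by
  rw [← integral_sub Integrable.of_finite Integrable.of_finite]
  exact (abs_integral_le_integral_abs).trans (integral_mono Integrable.of_finite
    Integrable.of_finite fun a => abs_klDivergence_sub_le hreg hint hd a)

theorem tendsto_integral_trueMean_oscillation [PseudoMetricSpace Θ] [CompactSpace Θ] [Nonempty Θ]
    (hreg : ∀ a, ∀ᵐ y ∂E.trueKernel a, E.IsRegular M (a, y))
    (hint : ∀ a, Integrable M (E.trueKernel a)) (σ : ProbabilityMeasure A) :
    Tendsto (fun k => ∫ a, E.trueMean (E.oscillation k) a ∂(σ : Measure A)) atTop (𝓝 0) := by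
  have := Fintype.ofFinite A
  have h1 : Tendsto (fun k => ∑ a, (σ : Measure A).real {a} • E.trueMean (E.oscillation k) a)
      atTop (𝓝 (∑ a, (σ : Measure A).real {a} • (0 : ℝ))) :=
    tendsto_finsetSum _ fun a _ => (tendsto_trueMean_oscillation hreg hint a).const_smul _
  simp only [smul_zero, Finset.sum_const_zero] at h1
  exact h1.congr fun k => (integral_fintype Integrable.of_finite).symm

/-- If the posterior mass of every superlevel set of the average divergence vanishes, and only
optimal actions are played, then limits of the empirical distribution are equilibria. -/
theorem isGeneralizedBerkNash_of_concentration [TopologicalSpace A] [DiscreteTopology A]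
    [MetricSpace Θ] [CompactSpace Θ] [BorelSpace Θ]
    (hU : ∀ a, Continuous (E.expectedPayoff a)) {x : ℕ → A} {ν : ℕ → ProbabilityMeasure Θ}
    (hopt : ∀ n, x (n + 1) ∈ E.optimalActions (ν n)) {σ : ProbabilityMeasure A}
    (hσ : Tendsto (empiricalDistribution x) atTop (𝓝 σ))
    (hL : Continuous fun θ => ∫ a, E.klDivergence θ a ∂(σ : Measure A))
    (hconc : ∀ θ₀, ∀ ε > 0, Tendsto (fun n => (ν n : Measure Θ)
      {θ | ∫ a, E.klDivergence θ₀ a ∂(σ : Measure A) + ε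
        < ∫ a, E.klDivergence θ a ∂(σ : Measure A)}) atTop (𝓝 0)) :
    E.IsGeneralizedBerkNash σ := by
  intro a ha
  -- Shifted by one because the action at `n + 1` is optimal for the belief `ν n`.
  have hfreq : ∃ᶠ n in atTop, x (n + 1) = a := by
    have h1 := frequently_eq_of_mem_support hσ ha
    rw [frequently_atTop] at h1 ⊢
    intro N
    obtain ⟨m, hm, hxm⟩ := h1 (N + 1)
    exact ⟨m - 1, by omega, by rwa [Nat.sub_add_cancel (by omega)]⟩
  have hne : (atTop ⊓ 𝓟 {n | x (n + 1) = a}).NeBot := frequently_mem_iff_neBot.1 hfreq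
  -- An ultrafilter on the periods at which `a` is played replaces a subsequence: by compactness of
  -- the space of beliefs, `ν` converges along it.
  set u : Ultrafilter ℕ := Ultrafilter.of (atTop ⊓ 𝓟 {n | x (n + 1) = a}) with hu
  have hule : (u : Filter ℕ) ≤ atTop ⊓ 𝓟 {n | x (n + 1) = a} := Ultrafilter.of_le _
  have hutop : (u : Filter ℕ) ≤ atTop := hule.trans inf_le_left
  have hua : ∀ᶠ n in (u : Filter ℕ), x (n + 1) = a :=
    (hule.trans inf_le_right) (mem_principal_self _)
  obtain ⟨μ, -, hμ⟩ := isCompact_univ.ultrafilter_le_nhds (u.map ν) (by simp)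
  have hμ' : Tendsto ν u (𝓝 μ) := hμ
  refine ⟨μ, fun θ hθ θ' => ?_, fun a' => ?_⟩
  · refine le_of_forall_pos_le_add fun ε hε => ?_
    by_contra! hlt
    set G : Set Θ := {θ | ∫ a, E.klDivergence θ' a ∂(σ : Measure A) + ε
        < ∫ a, E.klDivergence θ a ∂(σ : Measure A)} with hG
    -- By the portmanteau inequality the limit belief gives the open set `G` mass at most `liminf ν
    -- n G = 0`, so no point of its support lies in `G`.
    have hGo : IsOpen G := isOpen_lt continuous_const hL
    have h1 := ProbabilityMeasure.le_liminf_measure_open_of_tendsto hμ' hGo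
    rw [((hconc θ' ε hε).mono_left hutop).liminf_eq] at h1
    have h2 := (Measure.mem_support_iff_forall θ).1 hθ G (hGo.mem_nhds hlt)
    exact absurd h1 (not_le.2 h2)
  · have hlim : ∀ b, Tendsto (fun n => ∫ θ, E.expectedPayoff b θ ∂(ν n : Measure Θ)) u
        (𝓝 (∫ θ, E.expectedPayoff b θ ∂(μ : Measure Θ))) := fun b => by
      simpa using ProbabilityMeasure.tendsto_iff_forall_integral_tendsto.1 hμ'
        (BoundedContinuousFunction.mkOfCompact ⟨E.expectedPayoff b, hU b⟩)
    refine le_of_tendsto_of_tendsto (hlim a') (hlim a) ?_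
    filter_upwards [hua] with n hn
    exact hn ▸ hopt n a'

theorem ae_isGeneralizedBerkNash [TopologicalSpace A] [DiscreteTopology A] [MetricSpace Θ]
    [CompactSpace Θ] [BorelSpace Θ] [Nonempty Θ] (hE : E.StandingAssumptions)
    {μ₀ : ProbabilityMeasure Θ} (hμ₀ : (μ₀ : Measure Θ).support = Set.univ)
    {φ : ℕ → Kernel (ProbabilityMeasure Θ) A} [∀ t, IsMarkovKernel (φ t)]
    (hφ : ∀ t μ, φ t μ (E.optimalActions μ) = 1) :
    ∀ᵐ ω ∂E.pathLaw μ₀ φ, ∀ σ : ProbabilityMeasure A,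
      Tendsto (empiricalDistribution fun t => (ω t).1) atTop (𝓝 σ) →
        E.IsGeneralizedBerkNash σ := by
  obtain ⟨M, hreg, hint⟩ := hE.exists_regular
  have hU := hE.continuous_expectedPayoff
  have hosc : ∀ᵐ ω ∂E.pathLaw μ₀ φ, ∀ k : ℕ, Tendsto (fun n : ℕ =>
      (n : ℝ)⁻¹ * ∑ i ∈ Finset.range n,
        (E.oscillation k (ω i) - E.trueMean (E.oscillation k) (ω i).1)) atTop (𝓝 0) :=
    ae_all_iff.2 fun k => ae_tendsto_average_sub_trueMean (E.measurable_oscillation k)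
      (memLp_two_of_abs_le_log (E.measurable_oscillation k) hreg hint fun z hz => by
        rw [abs_of_nonneg (E.oscillation_nonneg k z)]
        exact hz.oscillation_le k)
  have hlog : ∀ᵐ ω ∂E.pathLaw μ₀ φ, ∀ j : ℕ, Tendsto (fun n : ℕ =>
      (n : ℝ)⁻¹ * ∑ i ∈ Finset.range n, (E.logRatio (TopologicalSpace.denseSeq Θ j) (ω i)
        - E.trueMean (E.logRatio (TopologicalSpace.denseSeq Θ j)) (ω i).1)) atTop (𝓝 0) :=
    ae_all_iff.2 fun j => ae_tendsto_average_sub_trueMean (E.measurable_logRatio _)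
      (memLp_two_of_abs_le_log (E.measurable_logRatio _) hreg hint fun z hz => by
        have h1 := hz.abs_logRatio_le (TopologicalSpace.denseSeq Θ j)
        have h2 := abs_nonneg (E.logRatio (TopologicalSpace.denseSeq Θ j) z)
        linarith)
  -- All null sets are discarded before `σ` is introduced; from here on the argument is
  -- deterministic on a fixed path.
  filter_upwards [hosc, hlog, ae_pathLaw_of_forall_ae hreg,
    ae_mem_optimalActions (fun a => (hU a).stronglyMeasurable) hφ] with ω h1 h2 hω hopt σ hσ
  have hW := tendsto_integral_trueMean_oscillation hreg hint σ
  have hLW : ∀ (k : ℕ) (θ θ' : Θ), dist θ θ' < 1 / ((k : ℝ) + 1) → _ := fun k θ θ' hd =>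
    abs_integral_klDivergence_sub_le hreg hint σ hd
  have hL := continuous_of_abs_sub_le_modulus
    (L := fun θ => ∫ a, E.klDivergence θ a ∂(σ : Measure A)) hW hLW
  have hunif := tendstoUniformly_average_logRatio hω
    (L := fun θ => ∫ a, E.klDivergence θ a ∂(σ : Measure A)) hW hLW
    (fun k => tendsto_average_of_tendsto_sub_trueMean hσ (h1 k)) fun j => by
      simpa only [trueMean_logRatio] using tendsto_average_of_tendsto_sub_trueMean hσ (h2 j)
  exact isGeneralizedBerkNash_of_concentration hU hopt hσ hL fun θ₀ ε hε =>
    tendsto_posterior_superlevel hω hμ₀ hL hunif θ₀ hε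

end MisspecifiedLearning.LearningProblem

theorem mainTheorem7 {k d m : ℕ}
    (A : Set (EuclideanSpace ℝ (Fin k))) (hA : A.Finite) (hA_nonempty : A.Nonempty)
    (Θ : Set (EuclideanSpace ℝ (Fin d))) (hΘ : IsCompact Θ) (hΘ_nonempty : Θ.Nonempty)
    (Y : Set (EuclideanSpace ℝ (Fin m))) (hY : MeasurableSet Y)
    (E : MisspecifiedLearning.LearningProblem A Θ Y) (hE : E.StandingAssumptions)
    (μ₀ : ProbabilityMeasure Θ) (hμ₀ : (μ₀ : Measure Θ).support = Set.univ)
    (φ : ℕ → Kernel (ProbabilityMeasure Θ) A) [∀ t, IsMarkovKernel (φ t)]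
    (hφ : ∀ t μ, φ t μ (E.optimalActions μ) = 1) :
    ∀ᵐ ω ∂(E.pathLaw μ₀ φ), ∀ σ : ProbabilityMeasure A,
      Tendsto (MisspecifiedLearning.empiricalDistribution fun t => (ω t).1) atTop (𝓝 σ) →
        E.IsGeneralizedBerkNash σ := by
  -- Finiteness also supplies, by instance inference, the discrete topology and discrete σ-algebra
  -- on `A`.
  have : Finite A := hA
  have : CompactSpace Θ := isCompact_iff_compactSpace.1 hΘ
  have : Nonempty Θ := hΘ_nonempty.to_subtype
  exact MisspecifiedLearning.LearningProblem.ae_isGeneralizedBerkNash hE hμ₀ hφ
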